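/- Let $p\ge 1$ be an integer, let $\alpha\in(p,p+1)$, and let $\mu$ be a probability measure on $[0,\infty)$ with $\int t^p\,d\mu(t)<\infty$ and $\int t^{p+1}\,d\mu(t)=\infty$. *Notation.* Let $m_j=\int t^j\,d\mu(t)$ $(0\le j\le p)$ be the moments of $\mu$, and let $\kappa_1,\dots,\kappa_p$ be its free cumulants, determined by $m_n=\sum_{s=1}^n\sum_{i_1+\cdots+i_s=n-s}\kappa_s m_{i_1}\cdots m_{i_s}$ (with $i_1,\dots,i_s\ge 0$) for $1\le n\le p$. For $\eta,M,\delta>0$ put $\Gamma_{\eta,M}=\{z:\Im z>0,\ |\Re z|<\eta\,\Im z,\ |z|>M\}$ and $\Delta_{\eta,\delta}=\{z:\Im z<0,\ |\Re z|<-\eta\,\Im z,\ |z|<\delta\}$. A statement holds "as $z\to\infty$ n.t." (non-tangentially) if it holds, for every $\eta>0$, as $|z|\to\infty$ within $\Gamma_{\eta,1}$. Let $G(z)=\int\frac{1}{z-t}\,d\mu(t)$ for $\Im z>0$, and $H(z)=G(1/z)$ for $\Im z<0$. Choose $\delta(\eta)>0$ for each $\eta>0$ such that $H$ is injective on $\bigcup_{\eta>0}\Delta_{\eta,\delta(\eta)}$,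 let $L$ be the inverse of this restriction of $H$, and put $R(z)=\frac1{L(z)}-\frac1z$ and $\phi(z)=R(1/z)$ (the Voiculescu transform of $\mu$). For every $\eta>0$, $\phi$ is defined on $\Gamma_{\eta,M}$ and does not depend there on the choice of the radii, provided $M$ is large enough (depending on $\eta$ and on the choices compared). Define $$r_G(z)=z^{p+1}\Big(G(z)-\sum_{j=1}^{p+1}m_{j-1}z^{-j}\Big),\qquad r_\phi(z)=z^{p-1}\Big(\phi(z)-\sum_{j=0}^{p-1}\kappa_{j+1}z^{-j}\Big).$$ A real function $f$, measurable on a neighbourhood of $+\infty$, is regularly varying of index $\rho$ if $f(tx)/f(x)\to t^\rho$ as $x\to\infty$ for every $t>0$ (in particular $f$ is eventually non-zero; it may be negative). We write $f\sim g$ if $f/g\to1$, and $f\gg g$ if $g/f\to 0$. *Theorem.* The following are equivalent: (i) $y\mapsto\mu(y,\infty)$ is regularly varying of index $-\alpha$; (ii) $y\mapsto\Im r_G(iy)$ is regularly varying of index $-(\alpha-p)$; (iii) $y\mapsto\Im r_\phi(iy)$ is regularly varying of index $-(\alpha-p)$, $\Re r_\phi(iy)\gg y^{-1}$ as $y\to\infty$,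 and $r_\phi(z)\gg z^{-1}$ as $z\to\infty$ n.t. If any of these statements holds, then, as $z\to\infty$ n.t., $$r_G(z)\sim r_\phi(z)\gg z^{-1},$$ and, as $y\to\infty$, $$\Im r_\phi(iy)\sim\Im r_G(iy)\sim-\frac{\frac{\pi\alpha}{2}}{\cos\frac{\pi(\alpha-p)}{2}}\,y^p\mu(y,\infty)\gg\frac1y,$$ $$\Re r_\phi(iy)\sim\Re r_G(iy)\sim-\frac{\frac{\pi\alpha}{2}}{\sin\frac{\pi(\alpha-p)}{2}}\,y^p\mu(y,\infty)\gg\frac1y.$$ -/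

import Mathlib

open Filter Topology Asymptotics MeasureTheory Set

/-- The truncated cone `Γ_{η,M}` in the upper half plane. -/
def upperCone (η M : ℝ) : Set ℂ :=
  {z | 0 < z.im ∧ |z.re| < η * z.im ∧ M < ‖z‖}

/-- The truncated cone `Δ_{η,δ}` in the lower half plane. -/
def lowerCone (η δ : ℝ) : Set ℂ :=
  {z | z.im < 0 ∧ |z.re| < -(η * z.im) ∧ ‖z‖ < δ}

/-- The filter of `z → ∞` non-tangentially to the real line: for every `η > 0` one has `|z| → ∞`
inside the cone `{0 < Im z, |Re z| < η Im z}`. -/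
def ntAtInfty : Filter ℂ :=
  ⨆ (η : ℝ) (_ : 0 < η), ⨅ (M : ℝ) (_ : 0 < M), 𝓟 (upperCone η M)

theorem mem_ntAtInfty {s : Set ℂ} :
    s ∈ ntAtInfty ↔ ∀ η : ℝ, 0 < η → ∃ M : ℝ, 0 < M ∧ upperCone η M ⊆ s := by
  simp only [ntAtInfty, Filter.mem_iSup]
  refine forall₂_congr fun η _ => ?_
  refine (Filter.mem_biInf_of_directed (s := Ioi (0 : ℝ))
    (f := fun M : ℝ => 𝓟 (upperCone η M)) ?_ ?_).trans ?_
  · intro a ha b hb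
    refine ⟨max a b, lt_max_of_lt_left (mem_Ioi.1 ha), ?_, ?_⟩
    · exact Filter.principal_mono.2 fun z hz => ⟨hz.1, hz.2.1, (le_max_left a b).trans_lt hz.2.2⟩
    · exact Filter.principal_mono.2 fun z hz => ⟨hz.1, hz.2.1, (le_max_right a b).trans_lt hz.2.2⟩
  · exact ⟨1, mem_Ioi.2 one_pos⟩
  · simp [Filter.mem_principal]

/-- Convergence along `ntAtInfty` is non-tangential convergence in the `ε`-`M` sense. -/
theorem tendsto_ntAtInfty {f : ℂ → ℂ} {l : ℂ} :
    Tendsto f ntAtInfty (𝓝 l) ↔ ∀ ε : ℝ, 0 < ε → ∀ η : ℝ, 0 < η →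
      ∃ M : ℝ, 0 < M ∧ ∀ z ∈ upperCone η M, ‖f z - l‖ < ε := by
  rw [Metric.tendsto_nhds]
  refine forall₂_congr fun ε _ => ?_
  simp only [Filter.Eventually, mem_ntAtInfty, dist_eq_norm]
  rfl

/-- Regular variation at infinity of index `ρ`, for a real function (of either sign) which is
measurable on some half-line `[X, ∞)`. Taking `t = 1` shows that such an `f` is eventually
non-zero. -/
def RegularlyVarying (f : ℝ → ℝ) (ρ : ℝ) : Prop :=
  (∃ X : ℝ, Measurable (fun x : Ici X => f x)) ∧
    ∀ t : ℝ, 0 < t → Tendsto (fun x => f (t * x) / f x) atTop (𝓝 (t ^ ρ))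

/-- The class `𝓜_p`: probability measures on `[0, ∞)` with finite `p`-th moment and infinite
`(p+1)`-st moment. -/
structure MemM (p : ℕ) (μ : Measure ℝ) : Prop where
  isProbabilityMeasure : IsProbabilityMeasure μ
  nonneg : μ (Iio 0) = 0
  moment_lt_top : ∫⁻ t, ENNReal.ofReal (t ^ p) ∂μ < ⊤
  moment_succ_eq_top : ∫⁻ t, ENNReal.ofReal (t ^ (p + 1)) ∂μ = ⊤

noncomputable section

/-- The Cauchy transform `G_μ`. -/
def cauchyTransform (μ : Measure ℝ) (z : ℂ) : ℂ := ∫ t : ℝ, 1 / (z - (t : ℂ)) ∂μ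

/-- `H_μ(z) = G_μ(1/z)`, considered on the lower half plane. -/
def HTransform (μ : Measure ℝ) (z : ℂ) : ℂ := cauchyTransform μ (1 / z)

/-- The union over all openings `η > 0` of the truncated cones `Δ_{η,δ(η)}`. -/
def lowerConeUnion (δ : ℝ → ℝ) : Set ℂ := ⋃ (η : ℝ) (_ : 0 < η), lowerCone η (δ η)

/-- A choice of radii `δ(η) > 0` such that `H_μ` is injective on `⋃_η Δ_{η,δ(η)}`
(every probability measure admits such radii). -/
def coneRadius (μ : Measure ℝ) : ℝ → ℝ :=
  Classical.epsilon fun δ : ℝ → ℝ =>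
    (∀ η, 0 < η → 0 < δ η) ∧ InjOn (HTransform μ) (lowerConeUnion δ)

/-- The inverse `L_μ` of `H_μ` restricted to `⋃_η Δ_{η,δ(η)}`. It is meaningful on the image of
this set, which contains some `Δ_{η,δ'}` for each `η`; another choice of the radii gives the same
function on some `Δ_{η,δ''}` for each `η`. -/
def LTransform (μ : Measure ℝ) : ℂ → ℂ :=
  Function.invFunOn (HTransform μ) (lowerConeUnion (coneRadius μ))

/-- The R-transform `R_μ(z) = 1/L_μ(z) - 1/z`. -/
def RTransform (μ : Measure ℝ) (z : ℂ) : ℂ := 1 / LTransform μ z - 1 / z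

/-- The Voiculescu transform `φ_μ(z) = R_μ(1/z)`. -/
def voiculescuTransform (μ : Measure ℝ) (z : ℂ) : ℂ := RTransform μ (1 / z)

/-- The moments `m_j(μ)`. -/
def realMoment (μ : Measure ℝ) (j : ℕ) : ℝ := ∫ t, t ^ j ∂μ

/-- The free cumulants of a moment sequence `m` (with `m 0 = 1`), through the free moment-cumulant
recursion `m_n = ∑_{s=1}^n ∑_{i_1+⋯+i_s=n-s} κ_s m_{i_1} ⋯ m_{i_s}`; the inner sum of products of
moments is the coefficient of `X^(n-s)` in `(∑ m_i X^i)^s`. The term `s = 0` vanishes for `n ≥ 1`,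
and `κ_n` involves only `m_0, …, m_n`. -/
def freeCumulantOfMoments (m : ℕ → ℝ) (n : ℕ) : ℝ :=
  m n - ∑ s : Fin n, freeCumulantOfMoments m s *
    PowerSeries.coeff (n - (s : ℕ)) (PowerSeries.mk m ^ (s : ℕ))
termination_by n
decreasing_by exact s.isLt

/-- The moment-cumulant relation in closed form. -/
theorem moment_eq_sum_freeCumulant (m : ℕ → ℝ) (hm : m 0 = 1) (n : ℕ) :
    m n = ∑ s ∈ Finset.range (n + 1), freeCumulantOfMoments m s *
      PowerSeries.coeff (n - s) (PowerSeries.mk m ^ s) := by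
  rw [Finset.sum_range_succ, freeCumulantOfMoments.eq_def m n, Finset.sum_range]
  simp [PowerSeries.coeff_zero_eq_constantCoeff, hm]

/-- The free cumulants `κ_j(μ)`, meaningful for `j` up to the order of the last finite moment. -/
def freeCumulant (μ : Measure ℝ) (j : ℕ) : ℝ := freeCumulantOfMoments (realMoment μ) j

/-- The remainder `r_G(z) = z^{p+1} (G_μ(z) - ∑_{j=1}^{p+1} m_{j-1}(μ) z^{-j})`. -/
def remG (μ : Measure ℝ) (p : ℕ) (z : ℂ) : ℂ :=
  z ^ (p + 1) * (cauchyTransform μ z -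
    ∑ j ∈ Finset.Icc 1 (p + 1), (realMoment μ (j - 1) : ℂ) * z ^ (-(j : ℤ)))

/-- The remainder `r_φ(z) = z^{p-1} (φ_μ(z) - ∑_{j=0}^{p-1} κ_{j+1}(μ) z^{-j})`. -/
def remPhi (μ : Measure ℝ) (p : ℕ) (z : ℂ) : ℂ :=
  z ^ ((p : ℤ) - 1) * (voiculescuTransform μ z -
    ∑ j ∈ Finset.range p, (freeCumulant μ (j + 1) : ℂ) * z ^ (-(j : ℤ)))

end

/-! The remainder has the closed form `r_G(z) = ∫ t^(p+1) / (z - t) dμ(t)` (`remG_eq_powCauchy`), so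
on the imaginary axis `Im r_G(iy)` and `Re r_G(iy)` are `-y^p` times the integrals of `s^(p+1) / (1
+ s^2)` and `s^(p+2) / (1 + s^2)` at `s = t/y`. Everything about `μ` then reduces to a
Stieltjes-type transform of the tail.

Passing between `G` and `φ` needs no regular variation. From `G(z + φ(z)) = 1/z` and the
moment-cumulant relation, `r_φ - r_G = O(1/z)` in each cone (`exists_norm_remPhi_sub_remG_le`),
while the infinite moment of order `p + 1` forces `1/z = o(r_G)` and `1/y = o(Im r_G(iy))`
(`setIntegral_le_norm_mul_im`). Hence the remainders are equivalent, and so are their imaginary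
parts on the axis. The real parts are compared only once the tail is known to vary regularly.

From tail to transform: the layer-cake formula, Potter bounds and dominated convergence
(`tendsto_integral_stieltjesKernel_div`) give both asymptotic constants. From transform to tail
(`tendsto_tail_div_of_regularlyVarying`): in the coordinate `u = 1 / (1 + s^2)` on `[0, 1]`,
rescaling `y` multiplies the kernel by a resolvent `1 / (1 + ε u)`, up to a constant. Regular
variation of the transform is thus convergence of all resolvent integrals, hence weak convergence,
and the tail is recovered by sandwiching indicators between continuous functions. -/

/-! ### Resolvent estimates off the half-line and the integral form of `r_G` -/

/-- `z ≠ 0` stays away from the half-line `[0, ∞)`, with constant `K`. -/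
def HalfLineApart (K : ℝ) (z : ℂ) : Prop :=
  z ≠ 0 ∧ ∀ t : ℝ, 0 ≤ t → ‖z‖ ≤ K * ‖z - t‖ ∧ t ≤ K * ‖z - t‖

theorem halfLineApart_of_norm_le {K : ℝ} {z : ℂ} (hz : 0 < z.im) (h : ‖z‖ ≤ K * z.im) :
    HalfLineApart (K + 1) z := by
  refine ⟨fun h0 => by simp [h0] at hz, fun t ht => ?_⟩
  have h1 : z.im ≤ ‖z - t‖ := by
    simpa using (le_abs_self _).trans (Complex.abs_im_le_norm (z - t))
  have h2 : z.im ≤ ‖z‖ := (le_abs_self _).trans (Complex.abs_im_le_norm z)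
  have hK : 0 ≤ K := by
    by_contra! hc
    nlinarith
  have h3 : ‖z‖ ≤ K * ‖z - t‖ := h.trans (by gcongr)
  have h4 : t ≤ ‖z‖ + ‖z - t‖ := by
    have : ‖(t : ℂ)‖ ≤ ‖z‖ + ‖z - t‖ := by
      simpa using norm_sub_le z (z - t)
    rwa [Complex.norm_real, Real.norm_of_nonneg ht] at this
  constructor <;> nlinarith [norm_nonneg (z - t)]

theorem norm_le_of_mem_upperCone {η M : ℝ} {z : ℂ} (hz : z ∈ upperCone η M) :
    ‖z‖ ≤ (η + 1) * z.im := by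
  have := Complex.norm_le_abs_re_add_abs_im z
  rw [abs_of_pos hz.1] at this
  linarith [hz.2.1]

theorem halfLineApart_of_mem_upperCone {η M : ℝ} {z : ℂ} (hz : z ∈ upperCone η M) :
    HalfLineApart (η + 2) z := by
  convert halfLineApart_of_norm_le hz.1 (norm_le_of_mem_upperCone hz) using 1
  ring

namespace HalfLineApart

variable {K : ℝ} {z w : ℂ}

theorem norm_pos (hz : HalfLineApart K z) : 0 < ‖z‖ := norm_pos_iff.2 hz.1

theorem one_le (hz : HalfLineApart K z) : 1 ≤ K := by
  have := (hz.2 0 le_rfl).1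
  have h0 := hz.norm_pos
  simp only [Complex.ofReal_zero, sub_zero] at this
  by_contra! h
  nlinarith

theorem pos (hz : HalfLineApart K z) : 0 < K := one_pos.trans_le hz.one_le

theorem norm_sub_pos (hz : HalfLineApart K z) {t : ℝ} (ht : 0 ≤ t) : 0 < ‖z - t‖ := by
  have := (hz.2 t ht).1
  have h0 := hz.norm_pos
  by_contra! h
  nlinarith [hz.pos]

theorem sub_ne_zero (hz : HalfLineApart K z) {t : ℝ} (ht : 0 ≤ t) : z - t ≠ 0 :=
  norm_pos_iff.1 (hz.norm_sub_pos ht)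

theorem inv_norm_sub_le (hz : HalfLineApart K z) {t : ℝ} (ht : 0 ≤ t) :
    1 / ‖z - t‖ ≤ K / ‖z‖ := by
  rw [div_le_div_iff₀ (hz.norm_sub_pos ht) hz.norm_pos, one_mul]
  exact (hz.2 t ht).1

theorem div_norm_sub_le (hz : HalfLineApart K z) {t : ℝ} (ht : 0 ≤ t) :
    t / ‖z - t‖ ≤ K := by
  rw [div_le_iff₀ (hz.norm_sub_pos ht)]
  exact (hz.2 t ht).2

end HalfLineApart

/-- The integral `∫ t^k / (z - t) dμ(t)`. -/
noncomputable def powCauchy (μ : Measure ℝ) (k : ℕ) (z : ℂ) : ℂ := ∫ t : ℝ, (t : ℂ) ^ k / (z - t) ∂μ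

theorem measurable_pow_div_sub (k : ℕ) (z : ℂ) :
    Measurable fun t : ℝ => (t : ℂ) ^ k / (z - t) := by fun_prop

section Integrals

variable {μ : Measure ℝ} {K : ℝ} {z w : ℂ} {p : ℕ}

theorem integrable_pow_of_le [IsFiniteMeasure μ] (hp : Integrable (fun t : ℝ => t ^ p) μ) {j : ℕ}
    (hj : j ≤ p) : Integrable (fun t : ℝ => t ^ j) μ := by
  refine ((integrable_const (1 : ℝ)).add hp.norm).mono' (by fun_prop) (ae_of_all _ fun t => ?_)
  simp only [norm_pow, Pi.add_apply]
  rcases le_total ‖t‖ 1 with h | h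
  · have := pow_le_one₀ (n := j) (norm_nonneg t) h
    have := pow_nonneg (norm_nonneg t) p
    linarith
  · have := pow_le_pow_right₀ h hj
    linarith

/-- The bound `t ≤ K * ‖z - t‖` absorbs one factor `t`, so the moment of order `p` controls the
integral of `t^(p+1) / (z - t)`. -/
theorem norm_pow_succ_div_sub_le (hz : HalfLineApart K z) {t : ℝ} (ht : 0 ≤ t) :
    ‖(t : ℂ) ^ (p + 1) / (z - t)‖ ≤ K * t ^ p := by
  have := hz.div_norm_sub_le ht
  rw [norm_div, norm_pow, Complex.norm_real, Real.norm_of_nonneg ht, pow_succ, mul_div_assoc,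
    mul_comm K]
  gcongr

theorem integrable_pow_succ_div_sub (hμ : ∀ᵐ t ∂μ, 0 ≤ t) (hp : Integrable (fun t : ℝ => t ^ p) μ)
    (hz : HalfLineApart K z) : Integrable (fun t : ℝ => (t : ℂ) ^ (p + 1) / (z - t)) μ := by
  refine (hp.const_mul K).mono' (measurable_pow_div_sub _ _).aestronglyMeasurable ?_
  filter_upwards [hμ] with t ht using norm_pow_succ_div_sub_le hz ht

theorem integrable_one_div_sub [IsFiniteMeasure μ] (hμ : ∀ᵐ t ∂μ, 0 ≤ t)
    (hz : HalfLineApart K z) : Integrable (fun t : ℝ => 1 / (z - t)) μ := by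
  refine (integrable_const (K / ‖z‖)).mono'
    (by simpa using (measurable_pow_div_sub 0 z).aestronglyMeasurable) ?_
  filter_upwards [hμ] with t ht
  simpa using hz.inv_norm_sub_le ht

theorem integral_pow_nonneg (hμ : ∀ᵐ t ∂μ, 0 ≤ t) : 0 ≤ realMoment μ p :=
  integral_nonneg_of_ae (by filter_upwards [hμ] with t ht using pow_nonneg ht p)

theorem norm_powCauchy_le (hμ : ∀ᵐ t ∂μ, 0 ≤ t) (hp : Integrable (fun t : ℝ => t ^ p) μ)
    (hz : HalfLineApart K z) : ‖powCauchy μ (p + 1) z‖ ≤ K * realMoment μ p := by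
  rw [powCauchy, realMoment, ← integral_const_mul]
  refine norm_integral_le_of_norm_le (hp.const_mul K) ?_
  filter_upwards [hμ] with t ht using norm_pow_succ_div_sub_le hz ht

/-- In the resolvent identity one resolvent absorbs a factor `t` and the other supplies `1/‖z‖`. A
bounded displacement therefore costs only `O(1/z)`, with no moment beyond the `p`-th. -/
theorem norm_powCauchy_sub_le (hμ : ∀ᵐ t ∂μ, 0 ≤ t) (hp : Integrable (fun t : ℝ => t ^ p) μ)
    (hz : HalfLineApart K z) (hw : HalfLineApart K w) :
    ‖powCauchy μ (p + 1) z - powCauchy μ (p + 1) w‖ ≤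
      K ^ 2 * realMoment μ p * (‖z - w‖ / ‖z‖) := by
  rw [powCauchy, powCauchy, ← integral_sub (integrable_pow_succ_div_sub hμ hp hz)
    (integrable_pow_succ_div_sub hμ hp hw)]
  have : K ^ 2 * realMoment μ p * (‖z - w‖ / ‖z‖) =
      ∫ t, K ^ 2 * (‖z - w‖ / ‖z‖) * t ^ p ∂μ := by
    rw [integral_const_mul, realMoment]; ring
  rw [this]
  refine norm_integral_le_of_norm_le (hp.const_mul _) ?_
  filter_upwards [hμ] with t ht
  have e : (t : ℂ) ^ (p + 1) / (z - t) - (t : ℂ) ^ (p + 1) / (w - t) =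
      (t : ℂ) ^ p * (1 / (z - t)) * (t / (w - t)) * (w - z) := by
    have h1 := hz.sub_ne_zero ht
    have h2 := hw.sub_ne_zero ht
    field_simp
    ring
  rw [e]
  have h1 := hz.inv_norm_sub_le ht
  have h2 := hw.div_norm_sub_le ht
  simp only [norm_mul, norm_div, norm_one, norm_pow, Complex.norm_real, Real.norm_of_nonneg ht]
  rw [norm_sub_rev w z]
  calc t ^ p * (1 / ‖z - t‖) * (t / ‖w - t‖) * ‖z - w‖
      ≤ t ^ p * (K / ‖z‖) * K * ‖z - w‖ := by
        have := hz.pos; gcongr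
    _ = _ := by ring

theorem powCauchy_succ (hμ : ∀ᵐ t ∂μ, 0 ≤ t) (hp : Integrable (fun t : ℝ => t ^ p) μ)
    (hp' : Integrable (fun t : ℝ => (t : ℂ) ^ p / (z - t)) μ) (hz : HalfLineApart K z) :
    powCauchy μ (p + 1) z = z * powCauchy μ p z - realMoment μ p := by
  have h : ((realMoment μ p : ℝ) : ℂ) = ∫ t, (t : ℂ) ^ p ∂μ := by
    rw [realMoment, ← integral_complex_ofReal]; simp
  have h3 : Integrable (fun t : ℝ => (t : ℂ) ^ p) μ := by
    have := hp.ofReal (𝕜 := ℂ); simpa using this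
  rw [h, powCauchy, powCauchy, ← integral_const_mul, ← integral_sub (hp'.const_mul z) h3]
  refine integral_congr_ae ?_
  filter_upwards [hμ] with t ht
  have h1 := hz.sub_ne_zero ht
  field_simp
  ring

/-- Raising `p` by one multiplies the remainder by `z` and subtracts the next moment, which is the
recursion `powCauchy_succ`. -/
theorem remG_eq_powCauchy [IsFiniteMeasure μ] (hμ : ∀ᵐ t ∂μ, 0 ≤ t)
    (hp : Integrable (fun t : ℝ => t ^ p) μ) (hz : HalfLineApart K z) :
    remG μ p z = powCauchy μ (p + 1) z := by
  have hz0 := hz.1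
  induction p with
  | zero =>
    rw [powCauchy_succ hμ hp (by simpa using integrable_one_div_sub hμ hz) hz]
    simp only [remG, powCauchy, cauchyTransform]
    simp
    field_simp
  | succ p ih =>
    have hp0 := integrable_pow_of_le hp p.le_succ
    rw [powCauchy_succ hμ hp (integrable_pow_succ_div_sub hμ hp0 hz) hz, ← ih hp0]
    simp only [remG]
    rw [Finset.sum_Icc_succ_top (by omega)]
    have : z ^ (p + 1 + 1) * z ^ (-((p + 1 + 1 : ℕ) : ℤ)) = 1 := by
      rw [zpow_neg, zpow_natCast, mul_inv_cancel₀ (pow_ne_zero _ hz0)]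
    simp only [Nat.add_sub_cancel]
    linear_combination (-(realMoment μ (p + 1) : ℂ)) * this

end Integrals

/-! ### Lower bounds for `r_G` from the infinite moment -/

theorem MemM.ae_nonneg {p : ℕ} {μ : Measure ℝ} (hμ : MemM p μ) : ∀ᵐ t ∂μ, 0 ≤ t := by
  rw [ae_iff]
  convert hμ.nonneg using 2
  ext; simp

theorem MemM.integrable_pow {p : ℕ} {μ : Measure ℝ} (hμ : MemM p μ) :
    Integrable (fun t : ℝ => t ^ p) μ := by
  refine ⟨by fun_prop, ?_⟩
  rw [hasFiniteIntegral_iff_norm]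
  refine lt_of_eq_of_lt (lintegral_congr_ae ?_) hμ.moment_lt_top
  filter_upwards [hμ.ae_nonneg] with t ht
  rw [Real.norm_of_nonneg (pow_nonneg ht p)]

theorem MemM.not_integrable_pow_succ {p : ℕ} {μ : Measure ℝ} (hμ : MemM p μ) :
    ¬ Integrable (fun t : ℝ => t ^ (p + 1)) μ := by
  intro h
  have h1 := h.2
  rw [hasFiniteIntegral_iff_norm] at h1
  refine h1.ne ((lintegral_congr_ae ?_).trans hμ.moment_succ_eq_top)
  filter_upwards [hμ.ae_nonneg] with t ht
  rw [Real.norm_of_nonneg (pow_nonneg ht _)]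

/-- If the truncated moments stayed bounded, exhausting the line by `Iic A` would make `t^(p+1)`
integrable. -/
theorem MemM.exists_le_setIntegral {p : ℕ} {μ : Measure ℝ} (hμ : MemM p μ) (C : ℝ) :
    ∃ A : ℝ, 0 < A ∧ C ≤ ∫ t in Iic A, t ^ (p + 1) ∂μ := by
  have := hμ.isProbabilityMeasure
  by_contra! hc
  refine hμ.not_integrable_pow_succ
    ((aecover_Iic (μ := μ) (l := atTop) (b := id) tendsto_id
      ).integrable_of_integral_bounded_of_nonneg_ae C (fun A => ?_) ?_ ?_)
  · refine (integrable_const (|A| ^ (p + 1))).mono' (by fun_prop) ?_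
    filter_upwards [ae_restrict_of_ae hμ.ae_nonneg, ae_restrict_mem measurableSet_Iic] with t h0 hA
    rw [norm_pow, Real.norm_of_nonneg h0]
    exact pow_le_pow_left₀ h0 (le_trans hA (le_abs_self A)) _
  · filter_upwards [hμ.ae_nonneg] with t ht using pow_nonneg ht _
  · filter_upwards [eventually_gt_atTop 0] with A hA using (hc A hA).le

section

variable {μ : Measure ℝ} {K : ℝ} {z w : ℂ} {p : ℕ}

theorem im_pow_div_sub (k : ℕ) (z : ℂ) (t : ℝ) :
    ((t : ℂ) ^ k / (z - t)).im = -(z.im * (t ^ k / ‖z - t‖ ^ 2)) := by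
  rw [← Complex.ofReal_pow, Complex.div_im, Complex.normSq_eq_norm_sq]
  simp only [Complex.ofReal_im, Complex.ofReal_re, Complex.sub_im]
  ring

theorem im_powCauchy (hμ : ∀ᵐ t ∂μ, 0 ≤ t)
    (hp : Integrable (fun t : ℝ => t ^ p) μ) (hz : HalfLineApart K z) :
    (powCauchy μ (p + 1) z).im = -(z.im * ∫ t, t ^ (p + 1) / ‖z - t‖ ^ 2 ∂μ) := by
  have h := integral_im (integrable_pow_succ_div_sub hμ hp hz)
  rw [powCauchy, ← integral_const_mul, ← integral_neg]
  refine Eq.trans ?_ (h.symm.trans (integral_congr_ae (ae_of_all _ fun t => im_pow_div_sub _ _ _)))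
  rfl

theorem integrable_pow_succ_div_sq (hμ : ∀ᵐ t ∂μ, 0 ≤ t)
    (hp : Integrable (fun t : ℝ => t ^ p) μ) (hz : HalfLineApart K z) :
    Integrable (fun t : ℝ => t ^ (p + 1) / ‖z - t‖ ^ 2) μ := by
  refine (hp.const_mul (K / ‖z‖ * K)).mono'
    (by have : Measurable fun t : ℝ => t ^ (p + 1) / ‖z - t‖ ^ 2 := by fun_prop
        exact this.aestronglyMeasurable) ?_
  filter_upwards [hμ] with t ht
  rw [Real.norm_of_nonneg (by positivity)]
  have h1 := hz.inv_norm_sub_le ht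
  have h2 := hz.div_norm_sub_le ht
  calc t ^ (p + 1) / ‖z - t‖ ^ 2 = (1 / ‖z - t‖) * (t / ‖z - t‖) * t ^ p := by
        have := hz.norm_sub_pos ht
        field_simp
        ring
    _ ≤ _ := by
        have := hz.pos
        gcongr

/-- For `0 ≤ t ≤ ‖z‖` one has `‖z - t‖ ≤ 2‖z‖`, so the kernel in `im_powCauchy` is at least `t^(p+1)
/ (4‖z‖^2)`. Since the truncated moments are unbounded, `‖z‖ * |Im r_G(z)|` tends to infinity in
cones. -/
theorem setIntegral_le_norm_mul_im [IsFiniteMeasure μ] (hμ : ∀ᵐ t ∂μ, 0 ≤ t)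
    (hp : Integrable (fun t : ℝ => t ^ p) μ) (hz : 0 < z.im) (hK : ‖z‖ ≤ K * z.im)
    {A : ℝ} (hA : A ≤ ‖z‖) :
    ∫ t in Iic A, t ^ (p + 1) ∂μ ≤ 4 * K * (‖z‖ * -(powCauchy μ (p + 1) z).im) := by
  have hap := halfLineApart_of_norm_le hz hK
  have hn := hap.norm_pos
  have hK0 : 0 < K := by
    by_contra! h
    nlinarith
  have hi := integrable_pow_succ_div_sq hμ hp hap
  have h1 : ∫ t in Iic A, t ^ (p + 1) ∂μ ≤
      ∫ t in Iic A, (4 * ‖z‖ ^ 2) * (t ^ (p + 1) / ‖z - t‖ ^ 2) ∂μ := by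
    refine integral_mono_of_nonneg ?_ (hi.integrableOn.const_mul _) ?_
    · filter_upwards [ae_restrict_of_ae hμ] with t ht using pow_nonneg ht _
    · filter_upwards [ae_restrict_of_ae hμ, ae_restrict_mem measurableSet_Iic] with t ht htA
      have h2 : ‖z - t‖ ≤ 2 * ‖z‖ := by
        have := norm_sub_le z (t : ℂ)
        rw [Complex.norm_real, Real.norm_of_nonneg ht] at this
        have := le_trans (mem_Iic.1 htA) hA
        linarith
      have h3 := hap.norm_sub_pos ht
      have h4 : ‖z - t‖ ^ 2 ≤ 4 * ‖z‖ ^ 2 := by nlinarith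
      rw [mul_div_assoc', le_div_iff₀ (by positivity), mul_comm]
      exact mul_le_mul_of_nonneg_right h4 (pow_nonneg ht _)
  have h2 : ∫ t in Iic A, (4 * ‖z‖ ^ 2) * (t ^ (p + 1) / ‖z - t‖ ^ 2) ∂μ ≤
      ∫ t, (4 * ‖z‖ ^ 2) * (t ^ (p + 1) / ‖z - t‖ ^ 2) ∂μ := by
    refine setIntegral_le_integral (hi.const_mul _) ?_
    filter_upwards [hμ] with t ht
    positivity
  refine h1.trans (h2.trans ?_)
  rw [integral_const_mul, im_powCauchy hμ hp hap, neg_neg]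
  have h3 : 0 ≤ ∫ t, t ^ (p + 1) / ‖z - t‖ ^ 2 ∂μ :=
    integral_nonneg_of_ae (by filter_upwards [hμ] with t ht; positivity)
  calc _ = (4 * ‖z‖ * ∫ t, t ^ (p + 1) / ‖z - t‖ ^ 2 ∂μ) * ‖z‖ := by ring
    _ ≤ (4 * ‖z‖ * ∫ t, t ^ (p + 1) / ‖z - t‖ ^ 2 ∂μ) * (K * z.im) := by gcongr
    _ = _ := by ring

end

theorem MemM.isLittleO_inv_remG {p : ℕ} {μ : Measure ℝ} (hμ : MemM p μ) :
    (fun z : ℂ => z⁻¹) =o[ntAtInfty] remG μ p := by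
  have := hμ.isProbabilityMeasure
  rw [isLittleO_iff]
  intro c hc
  rw [Filter.Eventually, mem_ntAtInfty]
  intro η hη
  -- The factor `4 * (η + 1)` cancels the constant `4 * K`, where `K = η + 1` bounds `‖z‖ / Im z` in
  -- the cone.
  obtain ⟨A, hA, hC⟩ := hμ.exists_le_setIntegral (4 * (η + 1) * c⁻¹)
  refine ⟨A, hA, fun z hz => ?_⟩
  have h1 := setIntegral_le_norm_mul_im hμ.ae_nonneg hμ.integrable_pow hz.1
    (norm_le_of_mem_upperCone hz) hz.2.2.le
  have hap := halfLineApart_of_mem_upperCone hz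
  rw [← remG_eq_powCauchy hμ.ae_nonneg hμ.integrable_pow hap] at h1
  have h2 : c⁻¹ ≤ ‖z‖ * -(remG μ p z).im := by
    have h4 : 0 < 4 * (η + 1) := by positivity
    exact le_of_mul_le_mul_left (hC.trans h1) h4
  have h3 : -(remG μ p z).im ≤ ‖remG μ p z‖ :=
    (neg_le_abs _).trans (Complex.abs_im_le_norm _)
  have hn := hap.norm_pos
  have h4 : c⁻¹ ≤ ‖z‖ * ‖remG μ p z‖ := h2.trans (by gcongr)
  show ‖z⁻¹‖ ≤ _
  rw [norm_inv, inv_le_iff_one_le_mul₀ hn]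
  calc (1 : ℝ) = c * c⁻¹ := by field_simp
    _ ≤ c * (‖z‖ * ‖remG μ p z‖) := by gcongr
    _ = _ := by ring

theorem I_mul_mem_upperCone {η M y : ℝ} (hη : 0 < η) (hM : 0 < M) (hy : M < y) :
    Complex.I * (y : ℂ) ∈ upperCone η M := by
  have : 0 < y := hM.trans hy
  refine ⟨by simpa using this, ?_, ?_⟩
  · simp; positivity
  · simpa [abs_of_pos this] using hy

theorem MemM.isLittleO_inv_im_remG {p : ℕ} {μ : Measure ℝ} (hμ : MemM p μ) :
    (fun y : ℝ => y⁻¹) =o[atTop] fun y : ℝ => (remG μ p (Complex.I * (y : ℂ))).im := by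
  have := hμ.isProbabilityMeasure
  rw [isLittleO_iff]
  intro c hc
  obtain ⟨A, hA, hC⟩ := hμ.exists_le_setIntegral (4 * c⁻¹)
  filter_upwards [eventually_gt_atTop A] with y hy
  have hy0 : 0 < y := hA.trans hy
  have hn : ‖Complex.I * (y : ℂ)‖ = y := by simp [abs_of_pos hy0]
  have him : (Complex.I * (y : ℂ)).im = y := by simp
  have h1 := setIntegral_le_norm_mul_im (K := 1) (z := Complex.I * (y : ℂ)) hμ.ae_nonneg
    hμ.integrable_pow (A := A) (by simpa using hy0) (by rw [hn, him, one_mul])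
    (by rw [hn]; exact hy.le)
  rw [← remG_eq_powCauchy hμ.ae_nonneg hμ.integrable_pow
    (halfLineApart_of_mem_upperCone (I_mul_mem_upperCone one_pos hA hy)), hn] at h1
  have h3 := neg_le_abs (remG μ p (Complex.I * (y : ℂ))).im
  rw [norm_inv, Real.norm_of_nonneg hy0.le, Real.norm_eq_abs, inv_le_iff_one_le_mul₀ hy0]
  calc (1 : ℝ) = c * c⁻¹ := by field_simp
    _ ≤ c * (y * -(remG μ p (Complex.I * (y : ℂ))).im) := by gcongr; linarith
    _ ≤ c * (y * |(remG μ p (Complex.I * (y : ℂ))).im|) := by gcongr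
    _ = _ := by ring

/-! ### Injectivity, inversion and Lipschitz control of the Voiculescu transform -/

theorem one_div_mem_upperCone {η δ : ℝ} {v : ℂ} (hv : v ∈ lowerCone η δ) :
    1 / v ∈ upperCone η δ⁻¹ := by
  obtain ⟨h1, h2, h3⟩ := hv
  have h0 : v ≠ 0 := fun h => by simp [h] at h1
  have hn : 0 < Complex.normSq v := Complex.normSq_pos.2 h0
  rw [one_div]
  refine ⟨?_, ?_, ?_⟩
  · rw [Complex.inv_im]
    exact div_pos (by linarith) hn
  · rw [Complex.inv_re, Complex.inv_im, abs_div, abs_of_pos hn, mul_div_assoc']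
    exact div_lt_div_of_pos_right (by linarith) hn
  · rw [norm_inv]
    exact inv_strictAnti₀ (norm_pos_iff.2 h0) h3

theorem one_div_mem_lowerCone {η δ : ℝ} (hδ : 0 < δ) {w : ℂ} (hw : w ∈ upperCone η δ⁻¹) :
    1 / w ∈ lowerCone η δ := by
  obtain ⟨h1, h2, h3⟩ := hw
  have h0 : w ≠ 0 := fun h => by simp [h] at h1
  have hn : 0 < Complex.normSq w := Complex.normSq_pos.2 h0
  rw [one_div]
  refine ⟨?_, ?_, ?_⟩
  · rw [Complex.inv_im]
    exact div_neg_of_neg_of_pos (by linarith) hn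
  · rw [Complex.inv_re, Complex.inv_im, abs_div, abs_of_pos hn, mul_div_assoc', ← neg_div]
    exact div_lt_div_of_pos_right (by linarith) hn
  · rw [norm_inv]
    exact inv_lt_of_inv_lt₀ hδ h3

section

variable {μ : Measure ℝ}

/-- Points far out in cones (of possibly different openings) are separated by the Cauchy
transform. -/
theorem eq_of_cauchyTransform_eq [IsProbabilityMeasure μ] (hμ : ∀ᵐ t ∂μ, 0 ≤ t)
    (h1 : Integrable (fun t : ℝ => t) μ) {K₁ K₂ : ℝ} {w₁ w₂ : ℂ} (hw₁ : HalfLineApart K₁ w₁)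
    (hw₂ : HalfLineApart K₂ w₂) (hn₁ : 8 * K₁ ^ 2 * ∫ t, t ∂μ ≤ ‖w₁‖)
    (hn₂ : 8 * K₂ ^ 2 * ∫ t, t ∂μ ≤ ‖w₂‖)
    (h : cauchyTransform μ w₁ = cauchyTransform μ w₂) : w₁ = w₂ := by
  by_contra hne
  -- The square obeys the same bound as the first power; with `2ab ≤ a^2 + b^2` this controls mixed
  -- products using the first moment alone and keeps the two cone constants apart.
  have hb : ∀ {K : ℝ} {w : ℂ}, HalfLineApart K w → ∀ t : ℝ, 0 ≤ t →
      ‖(t : ℂ) / (w - t)‖ ≤ K ^ 2 / ‖w‖ * t ∧ ‖(t : ℂ) / (w - t)‖ ^ 2 ≤ K ^ 2 / ‖w‖ * t := by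
    intro K w hw t ht
    rw [norm_div, Complex.norm_real, Real.norm_of_nonneg ht]
    have e1 := hw.inv_norm_sub_le ht
    have e2 := hw.div_norm_sub_le ht
    have e3 := hw.norm_sub_pos ht
    have e4 := hw.norm_pos
    have e5 : t / ‖w - t‖ ≤ K / ‖w‖ * t := by
      rw [div_eq_mul_one_div, mul_comm]
      gcongr
    have e6 := hw.one_le
    constructor
    · refine e5.trans ?_
      gcongr
      nlinarith
    · calc (t / ‖w - t‖) ^ 2 = (t / ‖w - t‖) * (t / ‖w - t‖) := sq _
        _ ≤ K * (K / ‖w‖ * t) := by gcongr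
        _ = _ := by ring
  have hi : Integrable (fun t : ℝ => 1 / (w₁ - t) * (1 / (w₂ - t))) μ := by
    refine (integrable_const (K₁ / ‖w₁‖ * (K₂ / ‖w₂‖))).mono'
      (Measurable.aestronglyMeasurable (by fun_prop)) ?_
    filter_upwards [hμ] with t ht
    rw [norm_mul, norm_div, norm_div, norm_one]
    exact mul_le_mul (hw₁.inv_norm_sub_le ht) (hw₂.inv_norm_sub_le ht) (by positivity)
      (div_nonneg hw₁.pos.le (norm_nonneg _))
  -- By the resolvent identity, `G(w₁) = G(w₂)` with `w₁ ≠ w₂` kills this integral. But `w₁ * w₂`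
  -- times the integrand is close to `1` on average: the error is at most `3/2 * (1/8 + 1/8) < 1`.
  have hzero : ∫ t : ℝ, 1 / (w₁ - t) * (1 / (w₂ - t)) ∂μ = 0 := by
    have e : (w₂ - w₁) * ∫ t : ℝ, 1 / (w₁ - t) * (1 / (w₂ - t)) ∂μ = 0 := by
      rw [← sub_eq_zero.2 h, cauchyTransform, cauchyTransform,
        ← integral_sub (integrable_one_div_sub hμ hw₁) (integrable_one_div_sub hμ hw₂),
        ← integral_const_mul]
      refine integral_congr_ae ?_
      filter_upwards [hμ] with t ht
      have := hw₁.sub_ne_zero ht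
      have := hw₂.sub_ne_zero ht
      field_simp
      ring
    exact (mul_eq_zero.1 e).resolve_left (sub_ne_zero.2 (Ne.symm hne))
  have hone : ∫ t : ℝ, (1 - w₁ * w₂ * (1 / (w₁ - t) * (1 / (w₂ - t)))) ∂μ = 1 := by
    rw [integral_sub (integrable_const _) (hi.const_mul _), integral_const_mul, hzero]
    simp
  have hle : ‖∫ t : ℝ, (1 - w₁ * w₂ * (1 / (w₁ - t) * (1 / (w₂ - t)))) ∂μ‖ ≤
      ∫ t, (3 / 2 * (K₁ ^ 2 / ‖w₁‖ + K₂ ^ 2 / ‖w₂‖)) * t ∂μ := by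
    refine norm_integral_le_of_norm_le (h1.const_mul _) ?_
    filter_upwards [hμ] with t ht
    have := hw₁.sub_ne_zero ht
    have := hw₂.sub_ne_zero ht
    have e : 1 - w₁ * w₂ * (1 / (w₁ - t) * (1 / (w₂ - t))) =
        -((t : ℂ) / (w₁ - t) + t / (w₂ - t) + t / (w₁ - t) * (t / (w₂ - t))) := by
      field_simp
      ring
    rw [e, norm_neg]
    obtain ⟨a1, a2⟩ := hb hw₁ t ht
    obtain ⟨b1, b2⟩ := hb hw₂ t ht
    have n1 := norm_add₃_le (a := (t : ℂ) / (w₁ - t)) (b := t / (w₂ - t))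
      (c := t / (w₁ - t) * (t / (w₂ - t)))
    rw [norm_mul] at n1
    nlinarith [sq_nonneg (‖(t : ℂ) / (w₁ - t)‖ - ‖(t : ℂ) / (w₂ - t)‖)]
  rw [hone, integral_const_mul, norm_one] at hle
  have c1 : K₁ ^ 2 / ‖w₁‖ * ∫ t, t ∂μ ≤ 1 / 8 := by
    rw [div_mul_eq_mul_div, div_le_iff₀ hw₁.norm_pos]; linarith
  have c2 : K₂ ^ 2 / ‖w₂‖ * ∫ t, t ∂μ ≤ 1 / 8 := by
    rw [div_mul_eq_mul_div, div_le_iff₀ hw₂.norm_pos]; linarith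
  linarith

/-- The choice in `coneRadius` carries information only once such radii are known to exist. -/
theorem exists_coneRadius [IsProbabilityMeasure μ] (hμ : ∀ᵐ t ∂μ, 0 ≤ t)
    (h1 : Integrable (fun t : ℝ => t) μ) :
    ∃ δ : ℝ → ℝ, (∀ η, 0 < η → 0 < δ η) ∧ InjOn (HTransform μ) (lowerConeUnion δ) := by
  have h0 : 0 ≤ ∫ t, t ∂μ := integral_nonneg_of_ae hμ
  have hpos : ∀ η : ℝ, 0 < (8 * (η + 2) ^ 2 * ∫ t, t ∂μ) + 1 := fun η => by positivity
  refine ⟨fun η => ((8 * (η + 2) ^ 2 * ∫ t, t ∂μ) + 1)⁻¹, fun η _ => inv_pos.2 (hpos η), ?_⟩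
  intro v₁ hv₁ v₂ hv₂ h
  simp only [lowerConeUnion, mem_iUnion] at hv₁ hv₂
  obtain ⟨η₁, -, hv₁⟩ := hv₁
  obtain ⟨η₂, -, hv₂⟩ := hv₂
  have hw₁ := one_div_mem_upperCone hv₁
  have hw₂ := one_div_mem_upperCone hv₂
  have n1 := hw₁.2.2
  have n2 := hw₂.2.2
  rw [inv_inv] at n1 n2
  have := eq_of_cauchyTransform_eq hμ h1 (halfLineApart_of_mem_upperCone hw₁)
    (halfLineApart_of_mem_upperCone hw₂) (by linarith) (by linarith) h
  simpa using this

theorem coneRadius_spec [IsProbabilityMeasure μ] (hμ : ∀ᵐ t ∂μ, 0 ≤ t)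
    (h1 : Integrable (fun t : ℝ => t) μ) :
    (∀ η, 0 < η → 0 < coneRadius μ η) ∧
      InjOn (HTransform μ) (lowerConeUnion (coneRadius μ)) :=
  Classical.epsilon_spec (exists_coneRadius hμ h1)

/-- By injectivity, any solution `w` of `G(w) = 1/z` far out in some cone is the one selected by
`L`, so `φ(z)` can be computed from a solution found by other means. -/
theorem voiculescuTransform_eq_sub [IsProbabilityMeasure μ] (hμ : ∀ᵐ t ∂μ, 0 ≤ t)
    (h1 : Integrable (fun t : ℝ => t) μ) {η : ℝ} (hη : 0 < η) {w z : ℂ}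
    (hw : w ∈ upperCone η (coneRadius μ η)⁻¹) (h : cauchyTransform μ w = z⁻¹) :
    voiculescuTransform μ z = w - z := by
  obtain ⟨hδ, hinj⟩ := coneRadius_spec hμ h1
  have hmem : 1 / w ∈ lowerConeUnion (coneRadius μ) := by
    simp only [lowerConeUnion, mem_iUnion]
    exact ⟨η, hη, one_div_mem_lowerCone (hδ η hη) hw⟩
  have hH : HTransform μ (1 / w) = 1 / z := by simp [HTransform, h]
  have hL : LTransform μ (1 / z) = 1 / w := by
    rw [LTransform, ← hH]
    exact hinj.leftInvOn_invFunOn hmem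
  rw [voiculescuTransform, RTransform, hL, one_div_one_div, one_div_one_div]

/-- The defect `w - 1 / G(w)` of the reciprocal Cauchy transform is bounded and contracting far
out. -/
theorem exists_defect_bound [IsProbabilityMeasure μ] (hμ : ∀ᵐ t ∂μ, 0 ≤ t)
    (h1 : Integrable (fun t : ℝ => t) μ) (K : ℝ) :
    ∃ M C : ℝ, 0 < M ∧ 0 < C ∧ ∀ w, HalfLineApart K w → M ≤ ‖w‖ →
      cauchyTransform μ w ≠ 0 ∧ ‖w - (cauchyTransform μ w)⁻¹‖ ≤ C ∧
      ∀ w', HalfLineApart K w' → M ≤ ‖w'‖ →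
        ‖(w - (cauchyTransform μ w)⁻¹) - (w' - (cauchyTransform μ w')⁻¹)‖ ≤
          1 / 2 * ‖w - w'‖ := by
  have h1' : Integrable (fun t : ℝ => t ^ 1) μ := by simpa using h1
  have h0' : Integrable (fun t : ℝ => t ^ 0) μ := integrable_pow_of_le h1' zero_le_one
  set m := realMoment μ 1 with hm
  have hm0 : 0 ≤ m := integral_pow_nonneg hμ
  have hmz : realMoment μ 0 = 1 := by simp [realMoment]
  set A := (1 + |K|) * m with hA
  have hA0 : 0 ≤ A := by positivity
  set B := 2 * K ^ 2 * m + 4 * A * K ^ 2 with hB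
  have hB0 : 0 ≤ B := by positivity
  -- Beyond `2 * A` the quantity `w G(w)` is within `1/2` of `1`; beyond `2 * B` the Lipschitz
  -- constant `B / ‖w‖` of the defect drops below `1/2`.
  refine ⟨2 * A + 2 * B + 1, 2 * A + 1, by positivity, by positivity, ?_⟩
  -- Writing `P₁, P₂` for `powCauchy μ 1 w, powCauchy μ 2 w`, the relations `w G(w) = 1 + P₁` and `w
  -- P₁ = m + P₂` turn the defect into `(m + P₂) / (1 + P₁)`, which is bounded by means of the first
  -- moment.
  have key : ∀ w, HalfLineApart K w → 2 * A + 2 * B + 1 ≤ ‖w‖ →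
      cauchyTransform μ w = (1 + powCauchy μ 1 w) / w ∧ 1 / 2 ≤ ‖1 + powCauchy μ 1 w‖ ∧
      ‖m + powCauchy μ 2 w‖ ≤ A ∧
      w - (cauchyTransform μ w)⁻¹ = (m + powCauchy μ 2 w) / (1 + powCauchy μ 1 w) := by
    intro w hw hn
    have hw0 := hw.1
    have e1 : powCauchy μ 1 w = w * powCauchy μ 0 w - 1 := by
      have := powCauchy_succ hμ h0' (by simpa using integrable_one_div_sub hμ hw) hw
      rwa [hmz, Complex.ofReal_one] at this
    have e2 : powCauchy μ 2 w = w * powCauchy μ 1 w - m :=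
      powCauchy_succ hμ h1' (integrable_pow_succ_div_sub hμ h0' hw) hw
    have hG : cauchyTransform μ w = (1 + powCauchy μ 1 w) / w := by
      rw [e1, powCauchy, cauchyTransform]
      simp only [pow_zero]
      field_simp
      ring
    have e3 : ‖m + powCauchy μ 2 w‖ ≤ A := by
      have b := norm_powCauchy_le hμ h1' hw
      refine (norm_add_le _ _).trans ?_
      rw [Complex.norm_real, Real.norm_of_nonneg hm0, hA, abs_of_pos hw.pos]
      linarith
    have e4 : ‖powCauchy μ 1 w‖ ≤ 1 / 2 := by
      have : powCauchy μ 1 w = (m + powCauchy μ 2 w) / w := by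
        rw [e2]; field_simp; ring
      rw [this, norm_div, div_le_iff₀ hw.norm_pos]
      linarith
    have e5 : 1 / 2 ≤ ‖1 + powCauchy μ 1 w‖ := by
      have := norm_sub_norm_le (1 : ℂ) (-powCauchy μ 1 w)
      rw [norm_neg, norm_one, sub_neg_eq_add] at this
      linarith
    have e6 : 1 + powCauchy μ 1 w ≠ 0 := norm_pos_iff.1 (by linarith)
    refine ⟨hG, e5, e3, ?_⟩
    rw [hG, e2]
    field_simp
    ring
  intro w hw hn
  obtain ⟨g, g2, g3, g4⟩ := key w hw hn
  have g0 : 1 + powCauchy μ 1 w ≠ 0 := norm_pos_iff.1 (by linarith)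
  refine ⟨?_, ?_, fun w' hw' hn' => ?_⟩
  · rw [g]
    exact div_ne_zero g0 hw.1
  · rw [g4, norm_div, div_le_iff₀ (by linarith)]
    nlinarith
  · obtain ⟨k, k2, k3, k4⟩ := key w' hw' hn'
    have k0 : 1 + powCauchy μ 1 w' ≠ 0 := norm_pos_iff.1 (by linarith)
    have d1 := norm_powCauchy_sub_le hμ h1' hw hw'
    have d0 := norm_powCauchy_sub_le hμ h0' hw hw'
    rw [hmz, mul_one] at d0
    rw [g4, k4]
    have e : (m + powCauchy μ 2 w) / (1 + powCauchy μ 1 w) -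
        (m + powCauchy μ 2 w') / (1 + powCauchy μ 1 w') =
        (powCauchy μ 2 w - powCauchy μ 2 w') * (1 + powCauchy μ 1 w)⁻¹ -
        (m + powCauchy μ 2 w') * ((powCauchy μ 1 w - powCauchy μ 1 w') *
          ((1 + powCauchy μ 1 w)⁻¹ * (1 + powCauchy μ 1 w')⁻¹)) := by
      field_simp
      ring
    rw [e]
    have i1 : ‖(1 + powCauchy μ 1 w)⁻¹‖ ≤ 2 := by
      rw [norm_inv]; exact inv_le_of_inv_le₀ (by norm_num) (by linarith)
    have i2 : ‖(1 + powCauchy μ 1 w')⁻¹‖ ≤ 2 := by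
      rw [norm_inv]; exact inv_le_of_inv_le₀ (by norm_num) (by linarith)
    refine (norm_sub_le _ _).trans ?_
    simp only [norm_mul]
    calc _ ≤ K ^ 2 * m * (‖w - w'‖ / ‖w‖) * 2 +
          A * (K ^ 2 * (‖w - w'‖ / ‖w‖) * (2 * 2)) := by gcongr
      _ = B / ‖w‖ * ‖w - w'‖ := by rw [hB]; ring
      _ ≤ _ := by
        refine mul_le_mul_of_nonneg_right ?_ (norm_nonneg _)
        rw [div_le_iff₀ hw.norm_pos]
        linarith

/-- In a cone, large `‖z‖` forces large `Im z`, so a shift of size `C` is eventually absorbed by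
doubling the opening. -/
theorem exists_closedBall_subset_upperCone {η C M₀ : ℝ} (hη : 0 < η) (hC : 0 ≤ C) (hM₀ : 0 ≤ M₀) :
    ∃ M : ℝ, 0 < M ∧ ∀ z ∈ upperCone η M, Metric.closedBall z C ⊆ upperCone (2 * η) M₀ := by
  refine ⟨M₀ + C + 1 + (η + 1) * ((C + 2 * η * C) / η + C), by positivity, fun z hz w hw => ?_⟩
  rw [mem_closedBall_iff_norm] at hw
  have h1 := (Complex.abs_re_le_norm (w - z)).trans hw
  have h2 := (Complex.abs_im_le_norm (w - z)).trans hw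
  rw [Complex.sub_re, abs_le] at h1
  rw [Complex.sub_im, abs_le] at h2
  have h3 := norm_le_of_mem_upperCone hz
  obtain ⟨z1, z2, z3⟩ := hz
  have h4 : (C + 2 * η * C) / η + C < z.im := by
    have : (η + 1) * ((C + 2 * η * C) / η + C) < (η + 1) * z.im := by linarith
    exact lt_of_mul_lt_mul_left this (by positivity)
  have h5 : C + 2 * η * C < η * z.im := by
    have : (C + 2 * η * C) / η < z.im := by linarith
    rw [div_lt_iff₀ hη] at this
    linarith
  have h6 : 0 ≤ (C + 2 * η * C) / η := by positivity
  have h7 : 0 ≤ (η + 1) * ((C + 2 * η * C) / η + C) := by positivity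
  refine ⟨by linarith, ?_, ?_⟩
  · rw [abs_lt] at z2 ⊢
    constructor <;> nlinarith
  · have := norm_sub_norm_le z w
    rw [norm_sub_rev] at this
    linarith

/-- Far out in a cone, `z + φ(z)` is a right inverse of the reciprocal Cauchy transform, at bounded
distance from `z` and Lipschitz. -/
theorem exists_add_voiculescuTransform [IsProbabilityMeasure μ] (hμ : ∀ᵐ t ∂μ, 0 ≤ t)
    (h1 : Integrable (fun t : ℝ => t) μ) {η : ℝ} (hη : 0 < η) :
    ∃ M C : ℝ, 0 < M ∧ 0 < C ∧ ∀ z ∈ upperCone η M,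
      ‖voiculescuTransform μ z‖ ≤ C ∧
      z + voiculescuTransform μ z ∈ upperCone (2 * η) 1 ∧
      cauchyTransform μ (z + voiculescuTransform μ z) = z⁻¹ ∧
      ∀ z' ∈ upperCone η M, ‖(z + voiculescuTransform μ z) - (z' + voiculescuTransform μ z')‖ ≤
        2 * ‖z - z'‖ := by
  obtain ⟨M₁, C, hM₁, hC, hD⟩ := exists_defect_bound hμ h1 (2 * η + 2)
  have hδ := (coneRadius_spec hμ h1).1 (2 * η) (by positivity)
  obtain ⟨M, hM, hball⟩ := exists_closedBall_subset_upperCone (M₀ := M₁ + (coneRadius μ (2 * η))⁻¹ + 1)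
    hη hC.le (by positivity)
  have hδ' := inv_pos.2 hδ
  have key : ∀ z ∈ upperCone η M, z + voiculescuTransform μ z ∈ Metric.closedBall z C ∧
      cauchyTransform μ (z + voiculescuTransform μ z) = z⁻¹ := by
    intro z hz
    have hz0 : z ≠ 0 := (halfLineApart_of_mem_upperCone hz).1
    -- A fixed point of `f` solves `G(w) = 1/z`. The defect bound `C` keeps the ball of radius `C`
    -- invariant and the contraction constant is `1/2`, so Banach's theorem provides one.
    let f : ℂ → ℂ := fun w => z + (w - (cauchyTransform μ w)⁻¹)
    have hap : ∀ w ∈ Metric.closedBall z C, HalfLineApart (2 * η + 2) w ∧ M₁ ≤ ‖w‖ := by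
      intro w hw
      have := hball z hz hw
      exact ⟨halfLineApart_of_mem_upperCone this, by linarith [this.2.2]⟩
    have hmaps : MapsTo f (Metric.closedBall z C) (Metric.closedBall z C) := by
      intro w hw
      obtain ⟨a, b⟩ := hap w hw
      rw [mem_closedBall_iff_norm]
      simpa [f] using (hD w a b).2.1
    have hcontr : ContractingWith (1 / 2) (hmaps.restrict f _ _) := by
      refine ⟨by rw [← NNReal.coe_lt_coe]; norm_num, LipschitzWith.of_dist_le_mul fun x y => ?_⟩
      obtain ⟨a, b⟩ := hap x x.2
      obtain ⟨a', b'⟩ := hap y y.2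
      have := (hD x a b).2.2 y a' b'
      rw [Subtype.dist_eq, Subtype.dist_eq, dist_eq_norm, dist_eq_norm]
      simpa [f] using this
    obtain ⟨w, hw, hfix, -⟩ := hcontr.exists_fixedPoint' Metric.isClosed_closedBall.isComplete
      hmaps (Metric.mem_closedBall_self hC.le) (edist_ne_top _ _)
    obtain ⟨a, b⟩ := hap w hw
    have hG : cauchyTransform μ w = z⁻¹ := by
      have : z + (w - (cauchyTransform μ w)⁻¹) = w := hfix
      rw [← inv_inv (cauchyTransform μ w)]
      congr 1
      linear_combination -this
    have hcone := hball z hz hw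
    have hv := voiculescuTransform_eq_sub hμ h1 (η := 2 * η) (by positivity) (w := w) (z := z)
      ⟨hcone.1, hcone.2.1, by linarith [hcone.2.2]⟩ hG
    rw [hv]
    simp only [add_sub_cancel]
    exact ⟨hw, hG⟩
  refine ⟨M, C, hM, hC, fun z hz => ?_⟩
  obtain ⟨k1, k2⟩ := key z hz
  have hc := hball z hz k1
  refine ⟨?_, ⟨hc.1, hc.2.1, by linarith [hc.2.2]⟩, k2, fun z' hz' => ?_⟩
  · simpa [mem_closedBall_iff_norm] using k1
  · obtain ⟨k1', k2'⟩ := key z' hz'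
    have hc' := hball z' hz' k1'
    have := (hD _ (halfLineApart_of_mem_upperCone hc) (by linarith [hc.2.2])).2.2 _
      (halfLineApart_of_mem_upperCone hc') (by linarith [hc'.2.2])
    rw [k2, k2', inv_inv, inv_inv] at this
    set w := z + voiculescuTransform μ z
    set w' := z' + voiculescuTransform μ z'
    -- Here `w - z` is the defect at `w`, so `‖w - w'‖ ≤ ‖z - z'‖ + ‖w - w'‖ / 2`; this is where the
    -- constant `2` comes from.
    have e : w - w' = (z - z') + ((w - z) - (w' - z')) := by ring
    have := norm_add_le (z - z') ((w - z) - (w' - z'))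
    rw [← e] at this
    linarith

end

/-! ### Comparison of `r_φ` with `r_G` through the moment-cumulant relation -/

theorem Polynomial.exists_norm_eval_sub_le (q : Polynomial ℂ) (R : ℝ) :
    ∃ L : ℝ, 0 ≤ L ∧ ∀ a b : ℂ, ‖a‖ ≤ R → ‖b‖ ≤ R → ‖q.eval a - q.eval b‖ ≤ L * ‖a - b‖ := by
  obtain ⟨L, hL⟩ := (isCompact_closedBall (0 : ℂ) R).exists_bound_of_continuousOn
    (f := fun x => q.derivative.eval x) (by fun_prop)
  refine ⟨|L|, abs_nonneg _, fun a b ha hb => ?_⟩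
  refine (convex_closedBall (0 : ℂ) R).norm_image_sub_le_of_norm_hasDerivWithin_le
    (f := fun x => q.eval x) (f' := fun x => q.derivative.eval x)
    (fun x _ => (q.hasDerivAt x).hasDerivWithinAt) (fun x hx => (hL x hx).trans (le_abs_self L))
    (by simpa using hb) (by simpa using ha)

theorem Polynomial.exists_norm_eval_le (q : Polynomial ℂ) (R : ℝ) :
    ∃ L : ℝ, 0 ≤ L ∧ ∀ a : ℂ, ‖a‖ ≤ R → ‖q.eval a‖ ≤ L := by
  obtain ⟨L, hL⟩ := (isCompact_closedBall (0 : ℂ) R).exists_bound_of_continuousOn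
    (f := fun x => q.eval x) (by fun_prop)
  exact ⟨|L|, abs_nonneg _, fun a ha => (hL a (by simpa using ha)).trans (le_abs_self L)⟩

/-- The truncated functional equation `M(X) = C(X M(X))` between the moment and free cumulant
generating functions. -/
theorem X_pow_dvd_trunc_sub_sum_freeCumulant (m : ℕ → ℝ) (hm : m 0 = 1) (p : ℕ) :
    (Polynomial.X : Polynomial ℝ) ^ (p + 1) ∣ PowerSeries.trunc (p + 1) (PowerSeries.mk m) -
      ∑ s ∈ Finset.range (p + 1), Polynomial.C (freeCumulantOfMoments m s) *
        (Polynomial.X * PowerSeries.trunc (p + 1) (PowerSeries.mk m)) ^ s := by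
  rw [Polynomial.X_pow_dvd_iff]
  intro n hn
  rw [Polynomial.coeff_sub, PowerSeries.coeff_trunc, if_pos hn, PowerSeries.coeff_mk,
    moment_eq_sum_freeCumulant m hm n, Polynomial.finsetSum_coeff, sub_eq_zero]
  -- Terms with `s > n` carry the factor `X^s` and do not reach degree `n`; in degrees up to `p` the
  -- truncation is invisible.
  rw [← Finset.sum_subset (Finset.range_subset_range.2 hn)]
  · refine Finset.sum_congr rfl fun s hs => ?_
    have hs' : s ≤ n := by simpa [Nat.lt_succ_iff] using hs
    rw [Polynomial.coeff_C_mul, mul_pow]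
    congr 1
    obtain ⟨k, rfl⟩ := Nat.exists_eq_add_of_le' hs'
    rw [Polynomial.coeff_X_pow_mul, Nat.add_sub_cancel]
    have h := congrArg (fun q => q.coeff k)
      (PowerSeries.trunc_trunc_pow (PowerSeries.mk m) (p + 1) s)
    simp only [PowerSeries.coeff_trunc, if_pos (show k < p + 1 by omega)] at h
    rw [← h, ← Polynomial.coe_pow, Polynomial.coeff_coe]
  · intro s _ hs
    have hs' : n < s := by simpa using hs
    rw [Polynomial.coeff_C_mul, mul_pow, Polynomial.coeff_X_pow_mul', if_neg (by omega), mul_zero]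

section

variable {μ : Measure ℝ}

theorem cauchyTransform_eq_eval_trunc (p : ℕ) {w : ℂ} (hw : w ≠ 0) :
    cauchyTransform μ w = w⁻¹ *
      ((PowerSeries.trunc (p + 1) (PowerSeries.mk (realMoment μ))).map (algebraMap ℝ ℂ)).eval w⁻¹ +
      (w⁻¹) ^ (p + 1) * remG μ p w := by
  have h1 : ((PowerSeries.trunc (p + 1) (PowerSeries.mk (realMoment μ))).map
      (algebraMap ℝ ℂ)).eval w⁻¹ =
      ∑ j ∈ Finset.range (p + 1), (realMoment μ j : ℂ) * w⁻¹ ^ j := by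
    rw [Polynomial.eval_map, PowerSeries.eval₂_trunc_eq_sum_range]
    simp
  have h2 : ∑ j ∈ Finset.Icc 1 (p + 1), (realMoment μ (j - 1) : ℂ) * w ^ (-(j : ℤ)) =
      w⁻¹ * ∑ j ∈ Finset.range (p + 1), (realMoment μ j : ℂ) * w⁻¹ ^ j := by
    rw [Finset.mul_sum, Finset.range_eq_Ico, ← Finset.Ico_add_one_right_eq_Icc,
      ← Finset.sum_Ico_add' _ 0 (p + 1) 1]
    refine Finset.sum_congr rfl fun j _ => ?_
    rw [Nat.add_sub_cancel, zpow_neg, zpow_natCast, ← inv_pow, pow_succ]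
    ring
  rw [h1, ← h2, remG, ← mul_assoc, ← mul_pow, inv_mul_cancel₀ hw, one_pow]
  ring

theorem remPhi_eq_pow_mul (p : ℕ) {z : ℂ} (hz : z ≠ 0) :
    remPhi μ p z = z ^ p * (z⁻¹ * voiculescuTransform μ z -
      (∑ s ∈ Finset.range p, Polynomial.C (freeCumulant μ (s + 1) : ℂ) *
        Polynomial.X ^ (s + 1)).eval z⁻¹) := by
  have h : (∑ s ∈ Finset.range p, Polynomial.C (freeCumulant μ (s + 1) : ℂ) *
        Polynomial.X ^ (s + 1)).eval z⁻¹ =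
      z⁻¹ * ∑ j ∈ Finset.range p, (freeCumulant μ (j + 1) : ℂ) * z ^ (-(j : ℤ)) := by
    rw [Polynomial.eval_finsetSum, Finset.mul_sum]
    refine Finset.sum_congr rfl fun j _ => ?_
    rw [zpow_neg, zpow_natCast, ← inv_pow]
    simp
    ring
  rw [h, remPhi, ← mul_sub, ← mul_assoc, zpow_sub_one₀ hz, zpow_natCast]

/-- Both remainders agree up to `O(1/z)` in each cone. -/
theorem exists_norm_remPhi_sub_remG_le [IsProbabilityMeasure μ] (hμ : ∀ᵐ t ∂μ, 0 ≤ t) {p : ℕ}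
    (hp1 : 1 ≤ p) (hp : Integrable (fun t : ℝ => t ^ p) μ) {η : ℝ} (hη : 0 < η) :
    ∃ M A : ℝ, 0 < M ∧ 0 ≤ A ∧ ∀ z ∈ upperCone η M,
      ‖remPhi μ p z - remG μ p z‖ ≤ A * ‖z⁻¹‖ := by
  have h1 : Integrable (fun t : ℝ => t) μ := by simpa using integrable_pow_of_le hp hp1
  obtain ⟨M, C, hM, hC, hφ⟩ := exists_add_voiculescuTransform hμ h1 hη
  set m := realMoment μ with hm
  have hm0 : m 0 = 1 := by simp [hm, realMoment]
  set T := (PowerSeries.trunc (p + 1) (PowerSeries.mk m)).map (algebraMap ℝ ℂ) with hT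
  set c : Polynomial ℂ := ∑ s ∈ Finset.range p, Polynomial.C (freeCumulant μ (s + 1) : ℂ) *
        Polynomial.X ^ (s + 1) with hc
  obtain ⟨S, hS⟩ := X_pow_dvd_trunc_sub_sum_freeCumulant m hm0 p
  have hS' : ∀ v : ℂ, T.eval v - 1 - c.eval (v * T.eval v) =
      v ^ (p + 1) * (S.map (algebraMap ℝ ℂ)).eval v := by
    intro v
    have := congrArg (fun q : Polynomial ℝ => (q.map (algebraMap ℝ ℂ)).eval v) hS
    simp only [Polynomial.map_sub, Polynomial.map_mul, Polynomial.map_pow, Polynomial.map_X,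
      Polynomial.eval_sub, Polynomial.eval_mul, Polynomial.eval_pow, Polynomial.eval_X] at this
    -- The recursion returns `κ₀ = m₀ = 1`; this `s = 0` term is the `1` subtracted in `hS'`.
    have h0 : freeCumulantOfMoments m 0 = 1 := by
      rw [freeCumulantOfMoments.eq_def]; simp [hm0]
    rw [← this, Finset.sum_range_succ', h0, hc]
    simp only [Polynomial.map_add, Polynomial.map_sum, Polynomial.map_mul, Polynomial.map_pow,
      Polynomial.map_C, Polynomial.map_X, Polynomial.eval_add, Polynomial.eval_finsetSum,
      Polynomial.eval_mul, Polynomial.eval_pow, Polynomial.eval_C, Polynomial.eval_X, ← hT,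
      freeCumulant, ← hm, map_one, pow_zero, mul_one, Complex.coe_algebraMap,
      Polynomial.map_one, Polynomial.eval_one]
    rw [sub_sub, add_comm (1 : ℂ)]
  obtain ⟨S₀, hS₀, hSb⟩ := Polynomial.exists_norm_eval_le (S.map (algebraMap ℝ ℂ)) 1
  obtain ⟨T₀, hT₀, hTb⟩ := Polynomial.exists_norm_eval_le T 1
  obtain ⟨L, hL, hLb⟩ := Polynomial.exists_norm_eval_sub_le c (T₀ + 1)
  obtain ⟨L', hL', hLb'⟩ := Polynomial.exists_norm_eval_sub_le (Polynomial.X ^ p) 2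
  set K := 2 * η + 2 with hK
  have hmp : 0 ≤ m p := integral_pow_nonneg hμ
  set B := K * m p with hB
  have hK0 : 0 < K := by positivity
  have hB0 : 0 ≤ B := by positivity
  -- The `2 * C` ensures `‖w‖ ≥ ‖z‖ / 2` for `w = z + φ(z)`, since `‖φ(z)‖ ≤ C`.
  refine ⟨M + 1 + 2 * C, 2 ^ p * 2 * (S₀ + L * B) + L' * (2 * C) * B + K ^ 2 * m p * C,
    by positivity, by positivity, fun z hz => ?_⟩
  obtain ⟨f1, f2, f3, -⟩ := hφ z ⟨hz.1, hz.2.1, by linarith [hz.2.2]⟩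
  have hzn : M + 1 + 2 * C < ‖z‖ := hz.2.2
  have hzn0 : 0 < ‖z‖ := by linarith
  set w := z + voiculescuTransform μ z with hw
  have hwz : ‖w - z‖ ≤ C := by rw [hw, add_sub_cancel_left]; exact f1
  have hwap : HalfLineApart K w := halfLineApart_of_mem_upperCone f2
  have hzap : HalfLineApart K z :=
    halfLineApart_of_mem_upperCone (M := M)
      ⟨hz.1, by nlinarith [hz.1, hz.2.1], by linarith⟩
  have hw0 := hwap.1
  have hz0 := hzap.1
  have hwn : ‖z‖ / 2 ≤ ‖w‖ := by
    have := norm_sub_norm_le z w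
    rw [norm_sub_rev] at this
    linarith
  have hw1 : 1 < ‖w‖ := f2.2.2
  have hvn : ‖w⁻¹‖ ≤ 2 * ‖z⁻¹‖ := by
    rw [norm_inv, norm_inv, ← div_eq_mul_inv, inv_le_comm₀ (by linarith) (by positivity), inv_div]
    exact hwn
  have hv1 : ‖w⁻¹‖ ≤ 1 := by rw [norm_inv]; exact inv_le_one_of_one_le₀ hw1.le
  have hzw : ‖z * w⁻¹‖ ≤ 2 := by
    rw [norm_mul]
    calc ‖z‖ * ‖w⁻¹‖ ≤ ‖z‖ * (2 * ‖z⁻¹‖) := by gcongr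
      _ = 2 := by rw [norm_inv]; field_simp
  set v := w⁻¹ with hv
  set r := remG μ p w with hr
  have hrB : ‖r‖ ≤ B := by
    rw [hr, remG_eq_powCauchy hμ hp hwap]
    exact norm_powCauchy_le hμ hp hwap
  have hu : z⁻¹ = v * T.eval v + v ^ (p + 1) * r := by
    rw [← f3]
    exact cauchyTransform_eq_eval_trunc p hw0
  have hTv : ‖v * T.eval v‖ ≤ T₀ + 1 := by
    rw [norm_mul]
    nlinarith [hTb v hv1, norm_nonneg v, norm_nonneg (T.eval v)]
  have hu1 : ‖z⁻¹‖ ≤ T₀ + 1 := by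
    rw [norm_inv]
    have := inv_le_one_of_one_le₀ (show 1 ≤ ‖z‖ by linarith)
    linarith
  have hφu : z⁻¹ * voiculescuTransform μ z = T.eval v + v ^ p * r - 1 := by
    have e : voiculescuTransform μ z = w - z := by rw [hw]; ring
    rw [e, mul_sub, inv_mul_cancel₀ hz0, hu]
    have : v * w = 1 := inv_mul_cancel₀ hw0
    rw [pow_succ]
    linear_combination (T.eval v + v ^ p * r) * this
  -- Four errors, each `O(1/z)`: the polynomial remainder of the truncated functional equation, the
  -- replacement of `v T(v)` by the exact value `1/z` inside `c`, the factor `z^p` in place of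
  -- `w^p`, and the move of `r_G` from `w` to `z`.
  have hdecomp : remPhi μ p z - remG μ p z =
      (z * v) ^ p * (v * (S.map (algebraMap ℝ ℂ)).eval v) +
      z ^ p * (c.eval (v * T.eval v) - c.eval z⁻¹) + ((z * v) ^ p - 1) * r +
      (remG μ p w - remG μ p z) := by
    rw [remPhi_eq_pow_mul p hz0, hφu, ← hr]
    have := hS' v
    rw [mul_pow]
    rw [pow_succ] at this
    linear_combination z ^ p * this
  have b1 : ‖(z * v) ^ p * (v * (S.map (algebraMap ℝ ℂ)).eval v)‖ ≤
      2 ^ p * (2 * ‖z⁻¹‖ * S₀) := by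
    rw [norm_mul, norm_mul, norm_pow]
    gcongr
    exact hSb v hv1
  have b2 : ‖z ^ p * (c.eval (v * T.eval v) - c.eval z⁻¹)‖ ≤ 2 ^ p * (2 * ‖z⁻¹‖) * (L * B) := by
    have h := hLb _ _ hTv hu1
    have e : v * T.eval v - z⁻¹ = -(v ^ (p + 1) * r) := by rw [hu]; ring
    rw [e, norm_neg, norm_mul, norm_pow] at h
    rw [norm_mul, norm_pow]
    calc _ ≤ ‖z‖ ^ p * (L * (‖v‖ ^ (p + 1) * B)) := by
          refine mul_le_mul_of_nonneg_left (h.trans ?_) (by positivity)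
          gcongr
      _ = ‖z * v‖ ^ p * ‖v‖ * (L * B) := by rw [norm_mul, mul_pow, pow_succ]; ring
      _ ≤ _ := by gcongr
  have b3 : ‖((z * v) ^ p - 1) * r‖ ≤ L' * (2 * ‖z⁻¹‖ * C) * B := by
    have h := hLb' (z * v) 1 hzw (by simp)
    simp only [Polynomial.eval_pow, Polynomial.eval_X, one_pow] at h
    have e : z * v - 1 = -(v * (w - z)) := by
      have : v * w = 1 := inv_mul_cancel₀ hw0
      linear_combination this
    rw [e, norm_neg, norm_mul] at h
    rw [norm_mul]
    refine mul_le_mul (h.trans ?_) hrB (norm_nonneg _) (by positivity)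
    gcongr
  have b4 : ‖remG μ p w - remG μ p z‖ ≤ K ^ 2 * m p * (C * ‖z⁻¹‖) := by
    rw [remG_eq_powCauchy hμ hp hwap, remG_eq_powCauchy hμ hp hzap, norm_sub_rev]
    refine (norm_powCauchy_sub_le hμ hp hzap hwap).trans ?_
    rw [norm_sub_rev z w, norm_inv, div_eq_mul_inv]
    gcongr
  rw [hdecomp]
  refine (norm_add_le _ _).trans ?_
  have := norm_add₃_le (a := (z * v) ^ p * (v * (S.map (algebraMap ℝ ℂ)).eval v))
    (b := z ^ p * (c.eval (v * T.eval v) - c.eval z⁻¹)) (c := ((z * v) ^ p - 1) * r)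
  linarith

end

theorem MemM.isLittleO_remPhi_sub_remG {p : ℕ} (hp : 1 ≤ p) {μ : Measure ℝ} (hμ : MemM p μ) :
    (fun z => remPhi μ p z - remG μ p z) =o[ntAtInfty] remG μ p := by
  have := hμ.isProbabilityMeasure
  rw [isLittleO_iff]
  intro ε hε
  rw [Filter.Eventually, mem_ntAtInfty]
  intro η hη
  obtain ⟨M₁, A, hM₁, hA, hb⟩ :=
    exists_norm_remPhi_sub_remG_le hμ.ae_nonneg hp hμ.integrable_pow hη
  have h := isLittleO_iff.1 hμ.isLittleO_inv_remG (c := ε / (A + 1)) (by positivity)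
  obtain ⟨M₂, hM₂, h2⟩ := mem_ntAtInfty.1 h η hη
  refine ⟨M₁ + M₂, by positivity, fun z hz => ?_⟩
  have k1 := hb z ⟨hz.1, hz.2.1, by linarith [hz.2.2]⟩
  have k2 : ‖z⁻¹‖ ≤ ε / (A + 1) * ‖remG μ p z‖ :=
    h2 (show z ∈ upperCone η M₂ from ⟨hz.1, hz.2.1, by linarith [hz.2.2]⟩)
  show ‖remPhi μ p z - remG μ p z‖ ≤ ε * ‖remG μ p z‖
  calc _ ≤ (A + 1) * ‖z⁻¹‖ := k1.trans (by gcongr; linarith)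
    _ ≤ (A + 1) * (ε / (A + 1) * ‖remG μ p z‖) := by gcongr
    _ = _ := by field_simp

theorem MemM.isBigO_axis_remPhi_sub_remG {p : ℕ} (hp : 1 ≤ p) {μ : Measure ℝ} (hμ : MemM p μ) :
    (fun y : ℝ => remPhi μ p (Complex.I * y) - remG μ p (Complex.I * y)) =O[atTop]
      fun y : ℝ => y⁻¹ := by
  have := hμ.isProbabilityMeasure
  obtain ⟨M, A, hM, hA, hb⟩ :=
    exists_norm_remPhi_sub_remG_le hμ.ae_nonneg hp hμ.integrable_pow one_pos
  refine IsBigO.of_bound A ?_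
  filter_upwards [eventually_gt_atTop M] with y hy
  simpa using hb _ (I_mul_mem_upperCone one_pos hM hy)

/-- Regular variation includes measurability. Since `φ` is defined by choice, this is extracted from
the Lipschitz bound on `z + φ(z)`. -/
theorem MemM.exists_continuousOn_remPhi {p : ℕ} (hp : 1 ≤ p) {μ : Measure ℝ} (hμ : MemM p μ) :
    ∃ X : ℝ, ContinuousOn (fun y : ℝ => remPhi μ p (Complex.I * y)) (Ici X) := by
  have := hμ.isProbabilityMeasure
  have h1 : Integrable (fun t : ℝ => t) μ := by
    simpa using integrable_pow_of_le hμ.integrable_pow hp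
  obtain ⟨M, C, hM, -, hφ⟩ := exists_add_voiculescuTransform hμ.ae_nonneg h1 one_pos
  have hmem : ∀ y ∈ Ici (M + 1), Complex.I * (y : ℂ) ∈ upperCone 1 M := fun y hy =>
    I_mul_mem_upperCone one_pos hM (by linarith [mem_Ici.1 hy])
  have hI : ContinuousOn (fun y : ℝ => Complex.I * (y : ℂ)) (Ici (M + 1)) := by fun_prop
  have hW : ContinuousOn (fun z => z + voiculescuTransform μ z) (upperCone 1 M) := by
    refine (LipschitzOnWith.of_dist_le_mul (K := 2) fun z hz z' hz' => ?_).continuousOn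
    simpa [dist_eq_norm] using (hφ z hz).2.2.2 z' hz'
  have hφc : ContinuousOn (fun z => voiculescuTransform μ z) (upperCone 1 M) :=
    (hW.sub continuousOn_id).congr fun z _ => by simp
  have h0 : ∀ y ∈ Ici (M + 1), Complex.I * (y : ℂ) ≠ 0 := fun y hy =>
    (halfLineApart_of_mem_upperCone (hmem y hy)).1
  refine ⟨M + 1, ?_⟩
  refine (hI.zpow₀ _ fun y hy => Or.inl (h0 y hy)).mul ((hφc.comp hI hmem).sub ?_)
  exact continuousOn_finsetSum _ fun j _ =>
    continuousOn_const.mul (hI.zpow₀ _ fun y hy => Or.inl (h0 y hy))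

/-! ### Evaluation of the limiting integrals -/

/-- Write `1 / (1 + s^2)` as `∫ exp(-(1 + s^2) x) dx` and exchange the integrals: two Gamma
integrals appear, and the reflection formula combines them into a cosine. -/
theorem lintegral_rpow_div_one_add_sq {b : ℝ} (hb : b ∈ Ioo (-1 : ℝ) 1) :
    ∫⁻ s in Ioi (0 : ℝ), ENNReal.ofReal (s ^ (-b) / (1 + s ^ 2)) =
      ENNReal.ofReal (Real.pi / (2 * Real.cos (Real.pi * b / 2))) := by
  obtain ⟨hb1, hb2⟩ := hb
  have h1 : ∀ s ∈ Ioi (0 : ℝ), ENNReal.ofReal (s ^ (-b) / (1 + s ^ 2)) =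
      ∫⁻ x in Ioi (0 : ℝ), ENNReal.ofReal (s ^ (-b) * Real.exp (-(1 + s ^ 2) * x)) := by
    intro s hs
    have hs0 : (0 : ℝ) < s := hs
    have hp : 0 < 1 + s ^ 2 := by positivity
    rw [← ofReal_integral_eq_lintegral_ofReal ((exp_neg_integrableOn_Ioi 0 hp).const_mul _)
      (ae_of_all _ fun x => by positivity), integral_const_mul]
    congr 1
    rw [integral_exp_mul_Ioi (by linarith) 0, mul_zero, Real.exp_zero, neg_div_neg_eq, mul_one_div]
  have h2 : ∀ x ∈ Ioi (0 : ℝ),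
      ∫⁻ s in Ioi (0 : ℝ), ENNReal.ofReal (s ^ (-b) * Real.exp (-(1 + s ^ 2) * x)) =
      ENNReal.ofReal (1 / 2 * Real.Gamma ((1 - b) / 2) *
        (Real.exp (-x) * x ^ ((1 + b) / 2 - 1))) := by
    intro x hx
    have hx0 : (0 : ℝ) < x := hx
    have e : ∀ s : ℝ, s ^ (-b) * Real.exp (-(1 + s ^ 2) * x) =
        Real.exp (-x) * (s ^ (-b) * Real.exp (-x * s ^ (2 : ℝ))) := by
      intro s
      have : -(1 + s ^ 2) * x = -x + -x * s ^ (2 : ℝ) := by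
        rw [Real.rpow_two]; ring
      rw [this, Real.exp_add]; ring
    simp_rw [e]
    rw [← ofReal_integral_eq_lintegral_ofReal
      ((integrableOn_rpow_mul_exp_neg_mul_rpow (by linarith) two_pos hx0).const_mul _),
      integral_const_mul, integral_rpow_mul_exp_neg_mul_rpow two_pos (by linarith) hx0]
    · congr 1
      rw [show -(-b + 1) / 2 = (1 + b) / 2 - 1 by ring, show (-b + 1) / 2 = (1 - b) / 2 by ring]
      ring
    · filter_upwards [ae_restrict_mem measurableSet_Ioi] with s hs
      have : (0 : ℝ) < s := hs
      positivity
  rw [setLIntegral_congr_fun measurableSet_Ioi h1, lintegral_lintegral_swap,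
    setLIntegral_congr_fun measurableSet_Ioi h2,
    ← ofReal_integral_eq_lintegral_ofReal
      ((Real.GammaIntegral_convergent (by linarith)).const_mul _)]
  · rw [integral_const_mul, ← Real.Gamma_eq_integral (by linarith)]
    congr 1
    have h := Real.Gamma_mul_Gamma_one_sub ((1 - b) / 2)
    rw [show 1 - (1 - b) / 2 = (1 + b) / 2 by ring,
      show Real.pi * ((1 - b) / 2) = Real.pi / 2 - Real.pi * b / 2 by ring,
      Real.sin_pi_div_two_sub] at h
    rw [mul_assoc, h]
    field_simp
  · filter_upwards [ae_restrict_mem measurableSet_Ioi] with s hs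
    have : (0 : ℝ) < s := hs
    have := Real.Gamma_pos_of_pos (show 0 < (1 - b) / 2 by linarith)
    positivity
  · exact Measurable.aemeasurable (by fun_prop)

theorem cos_pi_mul_div_two_pos {b : ℝ} (hb : b ∈ Ioo (-1 : ℝ) 1) :
    0 < Real.cos (Real.pi * b / 2) :=
  Real.cos_pos_of_mem_Ioo ⟨by nlinarith [Real.pi_pos, hb.1], by nlinarith [Real.pi_pos, hb.2]⟩

theorem integrableOn_rpow_div_one_add_sq {b : ℝ} (hb : b ∈ Ioo (-1 : ℝ) 1) :
    IntegrableOn (fun s : ℝ => s ^ (-b) / (1 + s ^ 2)) (Ioi 0) := by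
  refine ⟨Measurable.aestronglyMeasurable (by fun_prop), ?_⟩
  rw [hasFiniteIntegral_iff_ofReal, lintegral_rpow_div_one_add_sq hb]
  · exact ENNReal.ofReal_lt_top
  · filter_upwards [ae_restrict_mem measurableSet_Ioi] with s hs
    have : (0 : ℝ) < s := hs
    positivity

theorem integral_rpow_div_one_add_sq {b : ℝ} (hb : b ∈ Ioo (-1 : ℝ) 1) :
    ∫ s in Ioi (0 : ℝ), s ^ (-b) / (1 + s ^ 2) = Real.pi / (2 * Real.cos (Real.pi * b / 2)) := by
  rw [integral_eq_lintegral_of_nonneg_ae, lintegral_rpow_div_one_add_sq hb, ENNReal.toReal_ofReal]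
  · have := cos_pi_mul_div_two_pos hb
    positivity
  · filter_upwards [ae_restrict_mem measurableSet_Ioi] with s hs
    have : (0 : ℝ) < s := hs
    positivity
  · exact (integrableOn_rpow_div_one_add_sq hb).1

/-! ### Potter bounds -/

section Potter

variable {T : ℝ → ℝ} {c Y : ℝ}

/-- Iterate the doubling inequality up to the largest `2^n ≤ s`; monotonicity covers the rest, at
the price of the factor `2^c`. -/
theorem Antitone.le_rpow_mul_of_doubling (hT : Antitone T) (hpos : ∀ y, 0 < T y) (hc : 0 ≤ c)
    (hY : 0 < Y) (h : ∀ y, Y ≤ y → T (2 * y) ≤ 2 ^ (-c) * T y) {y s : ℝ} (hy : Y ≤ y)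
    (hs : 1 ≤ s) : T (s * y) ≤ 2 ^ c * s ^ (-c) * T y := by
  have hy0 : 0 < y := hY.trans_le hy
  have hit : ∀ n : ℕ, T (2 ^ n * y) ≤ ((2 : ℝ) ^ n) ^ (-c) * T y := by
    intro n
    induction n with
    | zero => simp
    | succ n ih =>
      have h1 : Y ≤ 2 ^ n * y := hy.trans (le_mul_of_one_le_left hy0.le (one_le_pow₀ one_le_two))
      calc T (2 ^ (n + 1) * y) = T (2 * (2 ^ n * y)) := by ring_nf
        _ ≤ 2 ^ (-c) * (((2 : ℝ) ^ n) ^ (-c) * T y) := (h _ h1).trans (by gcongr)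
        _ = _ := by rw [pow_succ, Real.mul_rpow (by positivity) (by norm_num)]; ring
  obtain ⟨n, hn1, hn2⟩ := exists_nat_pow_near hs one_lt_two
  have hs0 : 0 < s := one_pos.trans_le hs
  calc T (s * y) ≤ T (2 ^ n * y) := hT (by gcongr)
    _ ≤ ((2 : ℝ) ^ n) ^ (-c) * T y := hit n
    _ ≤ 2 ^ c * s ^ (-c) * T y := by
      have := hpos y
      gcongr
      calc ((2 : ℝ) ^ n) ^ (-c) = 2 ^ c * ((2 : ℝ) ^ (n + 1)) ^ (-c) := by
            rw [pow_succ, Real.mul_rpow (by positivity) (by norm_num), Real.rpow_neg (x := 2)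
              (by norm_num)]
            have : (0 : ℝ) < 2 ^ c := by positivity
            field_simp
        _ ≤ 2 ^ c * s ^ (-c) := by
            gcongr 2 ^ c * ?_
            exact Real.rpow_le_rpow_of_nonpos hs0 hn2.le (by linarith)

theorem Antitone.rpow_mul_le_of_doubling (hT : Antitone T) (hpos : ∀ y, 0 < T y) (hc : 0 ≤ c)
    (hY : 0 < Y) (h : ∀ y, Y ≤ y → T y ≤ 2 ^ c * T (2 * y)) {y s : ℝ} (hy : Y ≤ y)
    (hs : 1 ≤ s) : T y ≤ 2 ^ c * s ^ c * T (s * y) := by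
  have hy0 : 0 < y := hY.trans_le hy
  have hit : ∀ n : ℕ, T y ≤ ((2 : ℝ) ^ n) ^ c * T (2 ^ n * y) := by
    intro n
    induction n with
    | zero => simp
    | succ n ih =>
      have h1 : Y ≤ 2 ^ n * y := hy.trans (le_mul_of_one_le_left hy0.le (one_le_pow₀ one_le_two))
      calc T y ≤ ((2 : ℝ) ^ n) ^ c * (2 ^ c * T (2 * (2 ^ n * y))) := ih.trans (by gcongr; exact h _ h1)
        _ = ((2 : ℝ) ^ n) ^ c * (2 ^ c * T (2 ^ (n + 1) * y)) := by ring_nf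
        _ = _ := by rw [pow_succ, Real.mul_rpow (by positivity) (by norm_num)]; ring
  obtain ⟨n, hn1, hn2⟩ := exists_nat_pow_near hs one_lt_two
  have hs0 : 0 < s := one_pos.trans_le hs
  calc T y ≤ ((2 : ℝ) ^ (n + 1)) ^ c * T (2 ^ (n + 1) * y) := hit _
    _ ≤ ((2 : ℝ) ^ (n + 1)) ^ c * T (s * y) := by
      gcongr
      exact hT (by gcongr)
    _ ≤ (2 * s) ^ c * T (s * y) := by
      have := hpos (s * y)
      gcongr
      rw [pow_succ, mul_comm]
      gcongr
    _ = _ := by rw [Real.mul_rpow (by norm_num) hs0.le]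

/-- A Potter-type bound for regularly varying tails. -/
theorem Antitone.exists_potter (hT : Antitone T) (hpos : ∀ y, 0 < T y) (hle : ∀ y, T y ≤ 1)
    {α ε : ℝ} (hε : 0 < ε) (hεα : ε ≤ α)
    (h : Tendsto (fun y => T (2 * y) / T y) atTop (𝓝 (2 ^ (-α)))) :
    ∃ Y C : ℝ, 0 < Y ∧ 0 ≤ C ∧ ∀ y, Y ≤ y → ∀ s, 0 < s →
      T (s * y) / T y ≤ C * (s ^ (-(α - ε)) + s ^ (-(α + ε))) := by
  have h1 := h.eventually_lt_const (u := 2 ^ (-(α - ε)))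
    (Real.rpow_lt_rpow_of_exponent_lt one_lt_two (by linarith))
  have h2 := h.eventually_const_lt (u := 2 ^ (-(α + ε)))
    (Real.rpow_lt_rpow_of_exponent_lt one_lt_two (by linarith))
  obtain ⟨Y, hY⟩ := eventually_atTop.1 (h1.and (h2.and (eventually_gt_atTop 0)))
  have hY0 : 0 < Y := (hY Y le_rfl).2.2
  have d1 : ∀ y, Y ≤ y → T (2 * y) ≤ 2 ^ (-(α - ε)) * T y := fun y hy =>
    ((div_lt_iff₀ (hpos y)).1 (hY y hy).1).le
  have d2 : ∀ y, Y ≤ y → T y ≤ 2 ^ (α + ε) * T (2 * y) := fun y hy => by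
    have := ((lt_div_iff₀ (hpos y)).1 (hY y hy).2.1).le
    rw [Real.rpow_neg (by norm_num), inv_mul_le_iff₀ (by positivity)] at this
    exact this
  set c := α + ε with hc
  have hc0 : 0 ≤ c := by linarith
  have hTY := hpos Y
  refine ⟨Y, 2 ^ (α - ε) + 2 ^ c + 2 ^ c / T Y, hY0, by positivity, fun y hy s hs => ?_⟩
  have hy0 : 0 < y := hY0.trans_le hy
  have hTy := hpos y
  set A := s ^ (-(α - ε))
  set B := s ^ (-c) with hB
  have hA0 : 0 < A := by positivity
  have hB0 : 0 < B := by positivity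
  have p1 : (0 : ℝ) < 2 ^ (α - ε) := by positivity
  have p2 : (0 : ℝ) < 2 ^ c := by positivity
  have p3 : (0 : ℝ) < 2 ^ c / T Y := by positivity
  have hB' : (1 / s) ^ c = B := by
    rw [hB, one_div, Real.inv_rpow hs.le, Real.rpow_neg hs.le]
  -- Three regimes: `s ≥ 1`; `s < 1` with `s * y ≥ Y`; and `s * y < Y`, where the doubling bounds do
  -- not apply at `s * y` but `T ≤ 1` and comparing `T Y` with `T y` suffices.
  suffices T (s * y) / T y ≤ 2 ^ (α - ε) * A ∨ T (s * y) / T y ≤ 2 ^ c * B ∨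
      T (s * y) / T y ≤ 2 ^ c / T Y * B by
    have q1 := mul_pos p1 hA0
    have q2 := mul_pos p1 hB0
    have q3 := mul_pos p2 hA0
    have q4 := mul_pos p2 hB0
    have q5 := mul_pos p3 hA0
    have q6 := mul_pos p3 hB0
    rcases this with h | h | h <;> linarith
  rcases le_or_gt 1 s with hs1 | hs1
  · left
    rw [div_le_iff₀ hTy]
    exact hT.le_rpow_mul_of_doubling hpos (by linarith) hY0 d1 hy hs1
  right
  rcases le_or_gt Y (s * y) with hsy | hsy
  · left
    rw [div_le_iff₀ hTy]
    have := hT.rpow_mul_le_of_doubling hpos hc0 hY0 d2 hsy (one_le_one_div hs hs1.le)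
    rwa [← mul_assoc, one_div_mul_cancel hs.ne', one_mul, hB'] at this
  · right
    have h3 := hT.rpow_mul_le_of_doubling hpos hc0 hY0 d2 le_rfl ((one_le_div hY0).2 hy)
    rw [div_mul_cancel₀ _ hY0.ne'] at h3
    have h4 : (y / Y) ^ c ≤ B := by
      rw [← hB']
      refine Real.rpow_le_rpow (by positivity) ?_ hc0
      rw [div_le_div_iff₀ hY0 hs]
      linarith
    rw [div_le_iff₀ hTy, div_mul_eq_mul_div, div_mul_eq_mul_div, le_div_iff₀ hTY]
    calc T (s * y) * T Y ≤ 1 * T Y := by gcongr; exact hle _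
      _ ≤ 2 ^ c * B * T y := by rw [one_mul]; exact h3.trans (by gcongr)

end Potter

/-! ### Abelian theorem -/

/-- The derivative of `s ↦ s ^ (m + 2) / (1 + s ^ 2)`. -/
noncomputable def stieltjesKernelDeriv (m : ℕ) (s : ℝ) : ℝ :=
  s ^ (m + 1) * ((m + 2) + m * s ^ 2) / (1 + s ^ 2) ^ 2

theorem continuous_stieltjesKernelDeriv (m : ℕ) : Continuous (stieltjesKernelDeriv m) := by
  unfold stieltjesKernelDeriv
  exact Continuous.div (by fun_prop) (by fun_prop) fun s => by positivity

theorem stieltjesKernelDeriv_nonneg (m : ℕ) {s : ℝ} (hs : 0 ≤ s) : 0 ≤ stieltjesKernelDeriv m s := by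
  unfold stieltjesKernelDeriv
  positivity

theorem integral_stieltjesKernelDeriv (m : ℕ) (s : ℝ) :
    ∫ x in (0 : ℝ)..s, stieltjesKernelDeriv m x = s ^ (m + 2) / (1 + s ^ 2) := by
  have h : ∀ x : ℝ, HasDerivAt (fun x : ℝ => x ^ (m + 2) / (1 + x ^ 2))
      (stieltjesKernelDeriv m x) x := by
    intro x
    have h1 : HasDerivAt (fun x : ℝ => 1 + x ^ 2) (2 * x) x := by
      simpa using (hasDerivAt_pow 2 x).const_add 1
    have h2 := (hasDerivAt_pow (m + 2) x).div h1 (by positivity)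
    refine h2.congr_deriv ?_
    unfold stieltjesKernelDeriv
    push_cast
    congr 1
    ring
  rw [intervalIntegral.integral_eq_sub_of_hasDerivAt (fun x _ => h x)
    ((continuous_stieltjesKernelDeriv m).intervalIntegrable _ _)]
  simp

/-- Layer-cake formula for the kernel. It is stated for arbitrary `ν` because it is also applied to
the infinite measure with tail `s^(-a)`. -/
theorem lintegral_stieltjesKernel (ν : Measure ℝ) (hν : ∀ᵐ t ∂ν, 0 ≤ t) (m : ℕ) {y : ℝ}
    (hy : 0 < y) :
    ∫⁻ t, ENNReal.ofReal ((t / y) ^ (m + 2) / (1 + (t / y) ^ 2)) ∂ν =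
      ∫⁻ s in Ioi (0 : ℝ), ν (Ioi (s * y)) * ENNReal.ofReal (stieltjesKernelDeriv m s) := by
  have h := lintegral_comp_eq_lintegral_meas_lt_mul ν (f := fun t => t / y)
    (g := stieltjesKernelDeriv m)
    (by filter_upwards [hν] with t ht using div_nonneg ht hy.le) (by fun_prop)
    (fun t _ => (continuous_stieltjesKernelDeriv m).intervalIntegrable _ _)
    (by
      filter_upwards [ae_restrict_mem measurableSet_Ioi] with s hs
      exact stieltjesKernelDeriv_nonneg m (le_of_lt hs))
  simp only [integral_stieltjesKernelDeriv] at h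
  rw [h]
  refine lintegral_congr fun s => ?_
  congr 2
  ext t
  simp [lt_div_iff₀ hy]

theorem lintegral_stieltjesKernelDeriv_mul_rpow (m : ℕ) {a : ℝ} (ha : 0 < a)
    (ham : a - m - 1 ∈ Ioo (-1 : ℝ) 1) :
    ∫⁻ s in Ioi (0 : ℝ), ENNReal.ofReal (s ^ (-a) * stieltjesKernelDeriv m s) =
      ENNReal.ofReal (a * (Real.pi / (2 * Real.cos (Real.pi * (a - m - 1) / 2)))) := by
  -- This measure has tail exactly `s^(-a)`. Reading the layer-cake formula backwards removes the
  -- derivative of the kernel and leaves the integral already evaluated by Gamma functions.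
  set ν := (volume.restrict (Ioi (0 : ℝ))).withDensity fun s => ENNReal.ofReal (a * s ^ (-a - 1))
    with hνdef
  have hm : Measurable fun s : ℝ => ENNReal.ofReal (a * s ^ (-a - 1)) := by fun_prop
  have hν : ∀ᵐ t ∂ν, 0 ≤ t := by
    refine (withDensity_absolutelyContinuous _ _).ae_le ?_
    filter_upwards [ae_restrict_mem measurableSet_Ioi] with s hs using le_of_lt hs
  have htail : ∀ s : ℝ, s ∈ Ioi (0 : ℝ) → ν (Ioi (s * 1)) * ENNReal.ofReal (stieltjesKernelDeriv m s)
      = ENNReal.ofReal (s ^ (-a) * stieltjesKernelDeriv m s) := by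
    intro s hs
    have hs0 : (0 : ℝ) < s := hs
    rw [mul_one, hνdef, withDensity_apply _ measurableSet_Ioi,
      Measure.restrict_restrict measurableSet_Ioi, Ioi_inter_Ioi, sup_eq_left.2 hs0.le,
      ← ofReal_integral_eq_lintegral_ofReal
        ((integrableOn_Ioi_rpow_of_lt (by linarith) hs0).const_mul a), integral_const_mul,
      integral_Ioi_rpow_of_lt (by linarith) hs0, ← ENNReal.ofReal_mul']
    · congr 2
      rw [show -a - 1 + 1 = -a by ring]
      field_simp
    · exact stieltjesKernelDeriv_nonneg m hs0.le
    · filter_upwards [ae_restrict_mem measurableSet_Ioi] with x hx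
      have : 0 < x := hs0.trans hx
      positivity
  rw [← setLIntegral_congr_fun measurableSet_Ioi htail, ← lintegral_stieltjesKernel ν hν m one_pos,
    hνdef, lintegral_withDensity_eq_lintegral_mul _ hm (by fun_prop)]
  simp only [Pi.mul_apply, div_one]
  rw [ENNReal.ofReal_mul ha.le, ← lintegral_rpow_div_one_add_sq ham,
    ← lintegral_const_mul _ (by fun_prop)]
  refine setLIntegral_congr_fun measurableSet_Ioi fun s hs => ?_
  have hs0 : (0 : ℝ) < s := hs
  rw [← ENNReal.ofReal_mul (by positivity), ← ENNReal.ofReal_mul ha.le]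
  congr 1
  rw [mul_assoc, mul_div_assoc', ← Real.rpow_natCast s (m + 2), ← Real.rpow_add hs0]
  congr 4
  push_cast
  ring

theorem integrableOn_rpow_mul_stieltjesKernelDeriv (m : ℕ) {a : ℝ} (ha : 0 < a)
    (ham : a - m - 1 ∈ Ioo (-1 : ℝ) 1) :
    IntegrableOn (fun s : ℝ => s ^ (-a) * stieltjesKernelDeriv m s) (Ioi 0) := by
  have := (continuous_stieltjesKernelDeriv m).measurable
  refine ⟨Measurable.aestronglyMeasurable (by fun_prop), ?_⟩
  rw [hasFiniteIntegral_iff_ofReal, lintegral_stieltjesKernelDeriv_mul_rpow m ha ham]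
  · exact ENNReal.ofReal_lt_top
  · filter_upwards [ae_restrict_mem measurableSet_Ioi] with s hs
    have : (0 : ℝ) < s := hs
    exact mul_nonneg (by positivity) (stieltjesKernelDeriv_nonneg m this.le)

theorem integral_rpow_mul_stieltjesKernelDeriv (m : ℕ) {a : ℝ} (ha : 0 < a)
    (ham : a - m - 1 ∈ Ioo (-1 : ℝ) 1) :
    ∫ s in Ioi (0 : ℝ), s ^ (-a) * stieltjesKernelDeriv m s =
      a * (Real.pi / (2 * Real.cos (Real.pi * (a - m - 1) / 2))) := by
  rw [integral_eq_lintegral_of_nonneg_ae, lintegral_stieltjesKernelDeriv_mul_rpow m ha ham,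
    ENNReal.toReal_ofReal]
  · have := cos_pi_mul_div_two_pos ham
    positivity
  · filter_upwards [ae_restrict_mem measurableSet_Ioi] with s hs
    have : (0 : ℝ) < s := hs
    exact mul_nonneg (by positivity) (stieltjesKernelDeriv_nonneg m this.le)
  · exact (integrableOn_rpow_mul_stieltjesKernelDeriv m ha ham).1

theorem integral_stieltjesKernel {μ : Measure ℝ} [IsFiniteMeasure μ] (hμ : ∀ᵐ t ∂μ, 0 ≤ t) (m : ℕ)
    {y : ℝ} (hy : 0 < y) :
    ∫ t, (t / y) ^ (m + 2) / (1 + (t / y) ^ 2) ∂μ =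
      ∫ s in Ioi (0 : ℝ), μ.real (Ioi (s * y)) * stieltjesKernelDeriv m s := by
  have hanti : Antitone fun s => μ.real (Ioi (s * y)) := fun a b hab =>
    measureReal_mono (Ioi_subset_Ioi (by gcongr))
  rw [integral_eq_lintegral_of_nonneg_ae, lintegral_stieltjesKernel μ hμ m hy,
    integral_eq_lintegral_of_nonneg_ae]
  · congr 1
    refine lintegral_congr fun s => ?_
    rw [ENNReal.ofReal_mul measureReal_nonneg, ofReal_measureReal]
  · filter_upwards [ae_restrict_mem measurableSet_Ioi] with s hs
    exact mul_nonneg measureReal_nonneg (stieltjesKernelDeriv_nonneg m (le_of_lt hs))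
  · exact (hanti.measurable.mul (continuous_stieltjesKernelDeriv m).measurable).aestronglyMeasurable
  · filter_upwards [hμ] with t ht
    positivity
  · exact Measurable.aestronglyMeasurable (by fun_prop)

/-- Abelian theorem for the Stieltjes-type kernels `s ^ (m + 2) / (1 + s ^ 2)`. -/
theorem tendsto_integral_stieltjesKernel_div {μ : Measure ℝ} [IsProbabilityMeasure μ]
    (hμ : ∀ᵐ t ∂μ, 0 ≤ t) (hpos : ∀ y, 0 < μ.real (Ioi y)) {α : ℝ} (hα : 0 < α)
    (h : ∀ s, 0 < s → Tendsto (fun y => μ.real (Ioi (s * y)) / μ.real (Ioi y)) atTop (𝓝 (s ^ (-α))))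
    (m : ℕ) (ham : α - m - 1 ∈ Ioo (-1 : ℝ) 1) :
    Tendsto (fun y => (∫ t, (t / y) ^ (m + 2) / (1 + (t / y) ^ 2) ∂μ) / μ.real (Ioi y)) atTop
      (𝓝 (α * (Real.pi / (2 * Real.cos (Real.pi * (α - m - 1) / 2))))) := by
  obtain ⟨h1, h2⟩ := ham
  -- Both `α - ε` and `α + ε` must stay in the window where the kernel integral converges, so that
  -- the Potter bound is an integrable majorant.
  obtain ⟨ε, hε, hε1, hε2, hε3⟩ : ∃ ε : ℝ, 0 < ε ∧ ε < α ∧ ε < α - m - 1 + 1 ∧ ε < 1 - (α - m - 1) := by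
    obtain ⟨ε, h0, h⟩ := exists_between (show 0 < min α (min (α - m - 1 + 1) (1 - (α - m - 1))) by
      simp only [lt_min_iff]; exact ⟨hα, by linarith, by linarith⟩)
    simp only [lt_min_iff] at h
    exact ⟨ε, h0, h.1, h.2.1, h.2.2⟩
  have hanti : Antitone fun s => μ.real (Ioi s) := fun a b hab =>
    measureReal_mono (Ioi_subset_Ioi hab)
  obtain ⟨Y, C, hY, hC, hb⟩ := hanti.exists_potter hpos (fun y => measureReal_le_one) hε hε1.le
    (h 2 two_pos)
  rw [← integral_rpow_mul_stieltjesKernelDeriv m hα ⟨h1, h2⟩]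
  have key : Tendsto (fun y => ∫ s in Ioi (0 : ℝ),
      μ.real (Ioi (s * y)) / μ.real (Ioi y) * stieltjesKernelDeriv m s) atTop
      (𝓝 (∫ s in Ioi (0 : ℝ), s ^ (-α) * stieltjesKernelDeriv m s)) := by
    refine tendsto_integral_filter_of_dominated_convergence
      (fun s => C * (s ^ (-(α - ε)) * stieltjesKernelDeriv m s +
        s ^ (-(α + ε)) * stieltjesKernelDeriv m s)) ?_ ?_ ?_ ?_
    · filter_upwards [eventually_gt_atTop 0] with y hy
      have : Antitone fun s => μ.real (Ioi (s * y)) := fun a b hab => hanti (by gcongr)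
      exact ((this.measurable.div_const _).mul
        (continuous_stieltjesKernelDeriv m).measurable).aestronglyMeasurable
    · filter_upwards [eventually_ge_atTop Y] with y hy
      filter_upwards [ae_restrict_mem measurableSet_Ioi] with s hs
      have hk := stieltjesKernelDeriv_nonneg m (le_of_lt hs)
      rw [Real.norm_of_nonneg (mul_nonneg (by positivity) hk)]
      calc _ ≤ C * (s ^ (-(α - ε)) + s ^ (-(α + ε))) * stieltjesKernelDeriv m s := by
            gcongr
            exact hb y hy s hs
        _ = _ := by ring
    · exact ((integrableOn_rpow_mul_stieltjesKernelDeriv m (by linarith)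
        ⟨by linarith, by linarith⟩).add (integrableOn_rpow_mul_stieltjesKernelDeriv m (by linarith)
        ⟨by linarith, by linarith⟩)).const_mul C
    · filter_upwards [ae_restrict_mem measurableSet_Ioi] with s hs
      exact (h s hs).mul_const _
  refine key.congr' ?_
  filter_upwards [eventually_gt_atTop 0] with y hy
  rw [integral_stieltjesKernel hμ m hy, ← integral_div]
  refine integral_congr_ae (ae_of_all _ fun s => ?_)
  ring

/-! ### Tauberian theorem by weak convergence on `[0, 1]` -/

/-- Convergence of the resolvent integrals `∫ 1 / (1 + ε u)` of finite measures on `[0, 1]` implies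
their weak convergence. -/
theorem tendsto_integral_unitInterval_of_resolvent {ι : Type*} {l : Filter ι}
    {P : ι → Measure unitInterval} {Q : Measure unitInterval} [∀ i, IsFiniteMeasure (P i)]
    [IsFiniteMeasure Q]
    (h : ∀ ε : ℝ, 0 ≤ ε → Tendsto (fun i => ∫ u, 1 / (1 + ε * (u : ℝ)) ∂P i) l
      (𝓝 (∫ u, 1 / (1 + ε * (u : ℝ)) ∂Q))) (φ : C(unitInterval, ℝ)) :
    Tendsto (fun i => ∫ u, φ u ∂P i) l (𝓝 (∫ u, φ u ∂Q)) := by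
  have hint : ∀ (ρ : Measure unitInterval) [IsFiniteMeasure ρ] (φ : C(unitInterval, ℝ)),
      Integrable (fun u => φ u) ρ := fun ρ _ φ =>
    φ.continuous.integrable_of_hasCompactSupport (HasCompactSupport.of_compactSpace _)
  let V : Submodule ℝ C(unitInterval, ℝ) :=
    { carrier := {φ | Tendsto (fun i => ∫ u, φ u ∂P i) l (𝓝 (∫ u, φ u ∂Q))}
      add_mem' := by
        intro a b ha hb
        simp only [mem_ofPred_eq, ContinuousMap.add_apply] at *
        rw [integral_add (hint _ a) (hint _ b)]
        refine (ha.add hb).congr fun i => (integral_add (hint _ a) (hint _ b)).symm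
      zero_mem' := by simpa using tendsto_const_nhds
      smul_mem' := by
        intro c a ha
        simp only [mem_ofPred_eq, ContinuousMap.smul_apply, integral_smul] at *
        exact ha.const_smul c }
  have hmass : Tendsto (fun i => (P i).real univ) l (𝓝 (Q.real univ)) := by
    simpa using h 0 le_rfl
  -- The admissible test functions are closed under uniform limits because the masses converge,
  -- which is the hypothesis at `ε = 0`.
  have hclosed : ∀ φ : C(unitInterval, ℝ),
      (∀ δ : ℝ, 0 < δ → ∃ ψ ∈ V, ∀ u, |φ u - ψ u| ≤ δ) → φ ∈ V := by
    intro φ hφ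
    show Tendsto _ _ _
    rw [Metric.tendsto_nhds]
    intro ε hε
    set B := Q.real univ + 1 with hB
    have hB0 : 0 < B := by positivity
    obtain ⟨ψ, hψ, hd⟩ := hφ (ε / (3 * B)) (by positivity)
    have hdist : ∀ (ρ : Measure unitInterval) [IsFiniteMeasure ρ], ρ.real univ ≤ B →
        |(∫ u, φ u ∂ρ) - (∫ u, ψ u ∂ρ)| ≤ ε / 3 := by
      intro ρ _ hρ
      rw [← integral_sub (hint _ φ) (hint _ ψ)]
      refine (norm_integral_le_of_norm_le_const (C := ε / (3 * B)) (f := fun u => φ u - ψ u)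
        (ae_of_all _ fun u => hd u)).trans ?_
      calc ε / (3 * B) * ρ.real univ ≤ ε / (3 * B) * B := by gcongr
        _ = _ := by field_simp
    have hψ' : Tendsto (fun i => ∫ u, ψ u ∂P i) l (𝓝 (∫ u, ψ u ∂Q)) := hψ
    filter_upwards [Metric.tendsto_nhds.1 hψ' (ε / 3) (by positivity),
      hmass.eventually_le_const (show Q.real univ < B by linarith)] with i hi hm
    have h1 := hdist (P i) hm
    have h2 := hdist Q (by linarith)
    rw [Real.dist_eq] at hi ⊢
    rw [abs_le] at h1 h2
    rw [abs_lt] at hi ⊢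
    constructor <;> linarith
  -- The absolute value only keeps the denominator positive for every real `ε`.
  let g : ℕ → ℝ → C(unitInterval, ℝ) := fun k ε =>
    ⟨fun u => (u : ℝ) ^ k / (1 + |ε| * u), by
      refine Continuous.div (by fun_prop) (by fun_prop) fun u => ?_
      have := u.2.1
      positivity⟩
  let X : ℕ → C(unitInterval, ℝ) := fun k => ⟨fun u => (u : ℝ) ^ k, by fun_prop⟩
  have hX : ∀ k, (∀ ε, 0 < ε → g k ε ∈ V) → X k ∈ V := by
    intro k hk
    refine hclosed _ fun δ hδ => ⟨g k δ, hk δ hδ, fun u => ?_⟩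
    have h0 := u.2.1
    have h1 := u.2.2
    have e : X k u - g k δ u = δ * ((u : ℝ) ^ k * (u / (1 + δ * u))) := by
      simp only [X, g, ContinuousMap.coe_mk, abs_of_pos hδ]
      field_simp
      ring
    rw [e, abs_of_nonneg (by positivity)]
    have h2 : (u : ℝ) / (1 + δ * u) ≤ 1 := by
      rw [div_le_one (by positivity)]
      nlinarith
    have h3 : (u : ℝ) ^ k ≤ 1 := pow_le_one₀ h0 h1
    calc δ * ((u : ℝ) ^ k * (u / (1 + δ * u))) ≤ δ * (1 * 1) := by gcongr
      _ = δ := by ring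
  -- Induction on `k` by `u^(k+1) / (1 + ε u) = ε⁻¹ (u^k - u^k / (1 + ε u))`, where `u^k` is the
  -- uniform limit of `u^k / (1 + δ u)` as `δ → 0`. Weierstrass approximation then finishes.
  have hg : ∀ k ε, 0 < ε → g k ε ∈ V := by
    intro k
    induction k with
    | zero =>
      intro ε hε
      show Tendsto _ _ _
      simpa [g, abs_of_pos hε] using h ε hε.le
    | succ k ih =>
      intro ε hε
      have e : g (k + 1) ε = ε⁻¹ • (X k - g k ε) := by
        ext u
        have h0 := u.2.1
        simp only [X, g, ContinuousMap.coe_mk, abs_of_pos hε, ContinuousMap.smul_apply,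
          ContinuousMap.sub_apply, smul_eq_mul]
        field_simp
        ring
      rw [e]
      exact V.smul_mem _ (V.sub_mem (hX k ih) (ih ε hε))
  have hpoly : ∀ q : Polynomial ℝ, q.toContinuousMapOn unitInterval ∈ V := by
    intro q
    have e : q.toContinuousMapOn unitInterval = ∑ k ∈ Finset.range (q.natDegree + 1), q.coeff k • X k := by
      ext u
      rw [ContinuousMap.sum_apply]
      simp [X, Polynomial.eval_eq_sum_range]
    rw [e]
    exact V.sum_mem fun k _ => V.smul_mem _ (hX k (hg k))
  refine hclosed φ fun δ hδ => ?_
  obtain ⟨q, hq⟩ := exists_polynomial_near_continuousMap 0 1 φ δ hδ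
  refine ⟨_, hpoly q, fun u => ?_⟩
  have h1 := (ContinuousMap.norm_coe_le_norm (q.toContinuousMapOn (Icc (0:ℝ) 1) - φ) u).trans hq.le
  rw [ContinuousMap.sub_apply, Real.norm_eq_abs, abs_sub_comm] at h1
  exact h1

/-- The measure with density `w` with respect to `ν`, pushed forward by `X`. -/
noncomputable def weightedMap (ν : Measure ℝ) (w : ℝ → ℝ) (X : ℝ → unitInterval) :
    Measure unitInterval :=
  (ν.withDensity fun t => ENNReal.ofReal (w t)).map X

theorem isFiniteMeasure_weightedMap {ν : Measure ℝ} {w : ℝ → ℝ} (hw : Integrable w ν)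
    (X : ℝ → unitInterval) : IsFiniteMeasure (weightedMap ν w X) := by
  have := isFiniteMeasure_withDensity_ofReal hw.2
  unfold weightedMap
  infer_instance

theorem integral_weightedMap {ν : Measure ℝ} {w : ℝ → ℝ} (hw : Measurable w)
    (hw0 : ∀ᵐ t ∂ν, 0 ≤ w t) {X : ℝ → unitInterval} (hX : Measurable X) {φ : unitInterval → ℝ}
    (hφ : Continuous φ) : ∫ u, φ u ∂weightedMap ν w X = ∫ t, w t * φ (X t) ∂ν := by
  rw [weightedMap, integral_map hX.aemeasurable hφ.aestronglyMeasurable,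
    integral_withDensity_eq_integral_toReal_smul (by fun_prop) (ae_of_all _ fun t => by simp)]
  refine integral_congr_ae ?_
  filter_upwards [hw0] with t ht
  simp [ENNReal.toReal_ofReal ht]

/-- The map `s ↦ 1 / (1 + s ^ 2)`. -/
noncomputable def invOneAddSq (s : ℝ) : unitInterval :=
  ⟨1 / (1 + s ^ 2), by positivity, by rw [div_le_one (by positivity)]; nlinarith [sq_nonneg s]⟩

theorem continuous_invOneAddSq : Continuous invOneAddSq :=
  Continuous.subtype_mk (Continuous.div (by fun_prop) (by fun_prop) fun s => by positivity) _

section Tauberian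

variable {μ : Measure ℝ} {p : ℕ} {α : ℝ}

/-- Weak convergence of the rescaled kernel measures, from regular variation of the transform. -/
theorem tendsto_integral_stieltjes_weight (hμ : ∀ᵐ t ∂μ, 0 ≤ t) (hαp : α - p ∈ Ioo (-1 : ℝ) 1)
    {F : ℝ → ℝ} (hF : ∀ y, 0 < y → F y = ∫ t, (t / y) ^ (p + 1) / (1 + (t / y) ^ 2) ∂μ)
    (hFpos : ∀ y, 0 < y → 0 < F y)
    (hint : ∀ y, 0 < y → Integrable (fun t => (t / y) ^ (p + 1) / (1 + (t / y) ^ 2)) μ)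
    (h : ∀ l, 0 < l → Tendsto (fun y => F (l * y) / F y) atTop (𝓝 (l ^ (-α))))
    (φ : C(unitInterval, ℝ)) :
    Tendsto (fun y => (∫ t, (t / y) ^ (p + 1) / (1 + (t / y) ^ 2) * φ (invOneAddSq (t / y)) ∂μ) / F y)
      atTop (𝓝 ((∫ s in Ioi (0 : ℝ), s ^ (-(α - p)) / (1 + s ^ 2) * φ (invOneAddSq s)) /
        (Real.pi / (2 * Real.cos (Real.pi * (α - p) / 2))))) := by
  set I := Real.pi / (2 * Real.cos (Real.pi * (α - p) / 2)) with hI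
  have hI0 : 0 < I := by
    have := cos_pi_mul_div_two_pos hαp
    positivity
  -- The value `0` for `y ≤ 0` makes the measures finite for every `y`.
  let w : ℝ → ℝ → ℝ := fun y t =>
    if 0 < y then (t / y) ^ (p + 1) / (1 + (t / y) ^ 2) / F y else 0
  have hw : ∀ y, 0 < y → w y = fun t => (t / y) ^ (p + 1) / (1 + (t / y) ^ 2) / F y := fun y hy => by
    ext t; simp [w, hy]
  have hwint : ∀ y, Integrable (w y) μ := by
    intro y
    rcases lt_or_ge 0 y with hy | hy
    · rw [hw y hy]
      exact (hint y hy).div_const _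
    · have : w y = fun _ => 0 := by ext t; simp [w, hy.not_gt]
      rw [this]
      exact integrable_zero _ _ _
  have hvint : IntegrableOn (fun s : ℝ => s ^ (-(α - p)) / (1 + s ^ 2) / I) (Ioi 0) :=
    (integrableOn_rpow_div_one_add_sq hαp).div_const I
  let P : ℝ → Measure unitInterval := fun y => weightedMap μ (w y) fun t => invOneAddSq (t / y)
  let Q : Measure unitInterval := weightedMap (volume.restrict (Ioi 0))
    (fun s : ℝ => s ^ (-(α - p)) / (1 + s ^ 2) / I) invOneAddSq
  have hPfin : ∀ y, IsFiniteMeasure (P y) := fun y => isFiniteMeasure_weightedMap (hwint y) _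
  have hQfin : IsFiniteMeasure Q := isFiniteMeasure_weightedMap hvint _
  have hP : ∀ y, 0 < y → ∀ φ : unitInterval → ℝ, Continuous φ → ∫ u, φ u ∂P y =
      (∫ t, (t / y) ^ (p + 1) / (1 + (t / y) ^ 2) * φ (invOneAddSq (t / y)) ∂μ) / F y := by
    intro y hy φ hφ
    have hFy := hFpos y hy
    show ∫ u, φ u ∂weightedMap μ (w y) (fun t => invOneAddSq (t / y)) = _
    rw [integral_weightedMap (by rw [hw y hy]; fun_prop) ?_
      (X := fun t => invOneAddSq (t / y)) (continuous_invOneAddSq.measurable.comp (by fun_prop)) hφ, hw y hy, ← integral_div]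
    · refine integral_congr_ae (ae_of_all _ fun t => ?_)
      ring
    · rw [hw y hy]
      filter_upwards [hμ] with t ht
      positivity
  have hQ : ∀ φ : unitInterval → ℝ, Continuous φ → ∫ u, φ u ∂Q =
      (∫ s in Ioi (0 : ℝ), s ^ (-(α - p)) / (1 + s ^ 2) * φ (invOneAddSq s)) / I := by
    intro φ hφ
    rw [integral_weightedMap (by fun_prop) ?_ continuous_invOneAddSq.measurable hφ, ← integral_div]
    · refine integral_congr_ae (ae_of_all _ fun t => ?_)
      ring
    · filter_upwards [ae_restrict_mem measurableSet_Ioi] with s hs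
      have : (0 : ℝ) < s := hs
      positivity
  have main := tendsto_integral_unitInterval_of_resolvent (P := P) (Q := Q) (l := atTop) ?_ φ
  · rw [hQ φ φ.continuous] at main
    refine main.congr' ?_
    filter_upwards [eventually_gt_atTop 0] with y hy using hP y hy φ φ.continuous
  intro ε hε
  -- With `u = 1 / (1 + s^2)` one has `1 / (1 + ε u) = (1 + s^2) / (l^2 + s^2)`. Hence the resolvent
  -- integral at scale `y` equals `l^(p-1) * F (l * y) / F y`, whose limit is given by `h`.
  set l := √(1 + ε) with hl
  have hl0 : 0 < l := by positivity
  have hl2 : l ^ 2 = 1 + ε := Real.sq_sqrt (by positivity)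
  have hcont : Continuous fun u : unitInterval => 1 / (1 + ε * (u : ℝ)) := by
    refine Continuous.div (by fun_prop) (by fun_prop) fun u => ?_
    have := u.2.1
    positivity
  have hres : ∀ s : ℝ, 1 / (1 + ε * (invOneAddSq s : ℝ)) = (1 + s ^ 2) / (l ^ 2 + s ^ 2) := by
    intro s
    simp only [invOneAddSq]
    rw [hl2]
    field_simp
    ring
  have hlim : ∫ u, 1 / (1 + ε * (u : ℝ)) ∂Q = l ^ ((p : ℝ) - 1) * l ^ (-α) := by
    rw [hQ _ hcont]
    have e := integral_comp_mul_left_Ioi (fun s : ℝ => s ^ (-(α - p)) / (l ^ 2 + s ^ 2)) 0 hl0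
    rw [mul_zero, smul_eq_mul] at e
    have e2 : ∫ s in Ioi (0 : ℝ), (l * s) ^ (-(α - p)) / (l ^ 2 + (l * s) ^ 2) =
        l ^ (-(α - p)) / l ^ 2 * I := by
      rw [hI, ← integral_rpow_div_one_add_sq hαp, ← integral_const_mul]
      refine setIntegral_congr_fun measurableSet_Ioi fun s hs => ?_
      have hs0 : (0 : ℝ) < s := hs
      rw [Real.mul_rpow hl0.le hs0.le]
      field_simp
    have e3 : ∫ s in Ioi (0 : ℝ), s ^ (-(α - p)) / (1 + s ^ 2) * (1 / (1 + ε * (invOneAddSq s : ℝ))) =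
        ∫ s in Ioi (0 : ℝ), s ^ (-(α - p)) / (l ^ 2 + s ^ 2) := by
      refine setIntegral_congr_fun measurableSet_Ioi fun s hs => ?_
      rw [hres]
      field_simp
    rw [e3, (eq_inv_mul_iff_mul_eq₀ hl0.ne').1 e |>.symm, e2, ← Real.rpow_add hl0]
    have e4 : l ^ ((p : ℝ) - 1 + -α) = l * (l ^ (-(α - p)) / l ^ 2) := by
      rw [show (p : ℝ) - 1 + -α = 1 + -(α - p) - 2 by ring, Real.rpow_sub hl0, Real.rpow_add hl0,
        Real.rpow_one, Real.rpow_two]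
      ring
    rw [e4]
    field_simp
  rw [hlim]
  refine ((h l hl0).const_mul _).congr' ?_
  filter_upwards [eventually_gt_atTop 0] with y hy
  rw [hP y hy _ hcont, hF (l * y) (by positivity), mul_div_assoc', ← integral_const_mul]
  congr 1
  refine integral_congr_ae (ae_of_all _ fun t => ?_)
  simp only
  rw [hres, Real.rpow_sub_one hl0.ne', Real.rpow_natCast]
  field_simp
  rw [← pow_succ, ← mul_pow]
  congr 1
  field_simp

/-- Tauberian theorem: regular variation of the Stieltjes-type transform `F` determines the tail. -/
theorem tendsto_tail_div_of_regularlyVarying [IsFiniteMeasure μ] (hμ : ∀ᵐ t ∂μ, 0 ≤ t) (hp : 1 ≤ p)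
    (hα : 0 < α) (hαp : α - p ∈ Ioo (-1 : ℝ) 1)
    {F : ℝ → ℝ} (hF : ∀ y, 0 < y → F y = ∫ t, (t / y) ^ (p + 1) / (1 + (t / y) ^ 2) ∂μ)
    (hFpos : ∀ y, 0 < y → 0 < F y)
    (hint : ∀ y, 0 < y → Integrable (fun t => (t / y) ^ (p + 1) / (1 + (t / y) ^ 2)) μ)
    (h : ∀ l, 0 < l → Tendsto (fun y => F (l * y) / F y) atTop (𝓝 (l ^ (-α))))
    {x : ℝ} (hx : 0 < x) :
    Tendsto (fun y => μ.real (Ioi (x * y)) / F y) atTop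
      (𝓝 (x ^ (-α) / α / (Real.pi / (2 * Real.cos (Real.pi * (α - p) / 2))))) := by
  set I := Real.pi / (2 * Real.cos (Real.pi * (α - p) / 2)) with hI
  have hI0 : 0 < I := by
    have := cos_pi_mul_div_two_pos hαp
    positivity
  -- A continuous ramp between the indicators of `(b, ∞)` and `(a, ∞)` bounds the tails on both
  -- sides. Letting `b` decrease or `a` increase to `x` closes the gap.
  have key : ∀ a b : ℝ, 0 < a → a < b → ∃ (G : ℝ → ℝ) (L : ℝ), Tendsto G atTop (𝓝 L) ∧
      b ^ (-α) / α / I ≤ L ∧ L ≤ a ^ (-α) / α / I ∧ ∀ y, 0 < y →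
      μ.real (Ioi (b * y)) / F y ≤ G y ∧ G y ≤ μ.real (Ioi (a * y)) / F y := by
    intro a b ha hab
    have hb := ha.trans hab
    set A := 1 / (1 + a ^ 2) with hA
    set B := 1 / (1 + b ^ 2) with hB
    have hBA : B < A := by
      rw [hA, hB]
      gcongr
    have hA1 : A < 1 := by
      rw [hA, div_lt_one (by positivity)]
      nlinarith
    let χ : ℝ → ℝ := fun u => max 0 (min 1 ((A - u) / (A - B)))
    have hχ0 : ∀ u, 0 ≤ χ u := fun u => le_max_left _ _
    have hχ1 : ∀ u, χ u ≤ 1 := fun u => max_le zero_le_one (min_le_left _ _)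
    have hχA : ∀ u, A ≤ u → χ u = 0 := fun u hu =>
      max_eq_left (le_trans (min_le_right _ _)
        (div_nonpos_of_nonpos_of_nonneg (by linarith) (by linarith)))
    have hχB : ∀ u, u ≤ B → χ u = 1 := fun u hu => by
      have : 1 ≤ (A - u) / (A - B) := by
        rw [le_div_iff₀ (by linarith)]; linarith
      simp [χ, min_eq_left this]
    have hχc : Continuous χ := by fun_prop
    -- In the coordinate `u` the kernel is `√(1 - u)^(p+1) / √u^(p-1)`, so `φ` is the ramp divided
    -- by the kernel. Since `p ≥ 1` it is continuous at `u = 0`; the maximum removes the singularity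
    -- at `u = 1` and changes nothing where `χ ≠ 0`.
    let φ : C(unitInterval, ℝ) := ⟨fun u => χ u * (√(u : ℝ) ^ (p - 1) / √(max (1 - u) (1 - A)) ^ (p + 1)),
      by
        refine (hχc.comp continuous_subtype_val).mul (Continuous.div (by fun_prop) (by fun_prop)
          fun u => ?_)
        have : 0 < max (1 - (u : ℝ)) (1 - A) := lt_max_of_lt_right (by linarith)
        positivity⟩
    have hφ : ∀ s : ℝ, 0 ≤ s →
        s ^ (p + 1) / (1 + s ^ 2) * φ (invOneAddSq s) = χ (1 / (1 + s ^ 2)) := by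
      intro s hs
      show s ^ (p + 1) / (1 + s ^ 2) * (χ (1 / (1 + s ^ 2)) * (√(1 / (1 + s ^ 2)) ^ (p - 1) /
        √(max (1 - 1 / (1 + s ^ 2)) (1 - A)) ^ (p + 1))) = χ (1 / (1 + s ^ 2))
      rcases le_or_gt A (1 / (1 + s ^ 2)) with hsA | hsA
      · rw [hχA _ hsA]; ring
      rw [max_eq_left (by linarith)]
      have hs0 : 0 < s := by
        rcases hs.eq_or_lt with rfl | h0
        · norm_num at hsA; linarith
        · exact h0
      have e1 : 1 - 1 / (1 + s ^ 2) = s ^ 2 * (1 / (1 + s ^ 2)) := by field_simp; ring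
      rw [e1, Real.sqrt_mul (by positivity), Real.sqrt_sq hs]
      obtain ⟨q, rfl⟩ := Nat.exists_eq_add_of_le' hp
      have e2 : √(1 / (1 + s ^ 2)) ^ 2 = 1 / (1 + s ^ 2) := Real.sq_sqrt (by positivity)
      set r := √(1 / (1 + s ^ 2)) with hr
      have hr0 : 0 < r := by positivity
      have e3 : 1 + s ^ 2 = 1 / r ^ 2 := by rw [e2]; simp
      rw [← e2, e3, Nat.add_sub_cancel, mul_pow]
      field_simp
      ring
    have hlow : ∀ s : ℝ, 0 ≤ s → s ≤ a → χ (1 / (1 + s ^ 2)) = 0 := fun s hs hsa =>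
      hχA _ (by rw [hA]; gcongr)
    have hupp : ∀ s : ℝ, b ≤ s → χ (1 / (1 + s ^ 2)) = 1 := fun s hs =>
      hχB _ (by rw [hB]; gcongr)
    have htend := tendsto_integral_stieltjes_weight hμ hαp hF hFpos hint h φ
    have hmeas : Measurable fun s : ℝ => χ (1 / (1 + s ^ 2)) := hχc.measurable.comp (by fun_prop)
    have hI2 : ∫ s in Ioi (0 : ℝ), s ^ (-(α - p)) / (1 + s ^ 2) * φ (invOneAddSq s) =
        ∫ s in Ioi (0 : ℝ), s ^ (-α - 1) * χ (1 / (1 + s ^ 2)) := by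
      refine setIntegral_congr_fun measurableSet_Ioi fun s hs => ?_
      have hs0 : (0 : ℝ) < s := hs
      rw [← hφ s hs0.le, ← mul_assoc, mul_div_assoc', ← Real.rpow_natCast s (p + 1),
        ← Real.rpow_add hs0]
      congr 3
      push_cast
      ring
    have hpow : ∀ c : ℝ, 0 < c → ∫ s in Ioi (0 : ℝ), (Ioi c).indicator (fun s => s ^ (-α - 1)) s =
        c ^ (-α) / α := by
      intro c hc
      rw [setIntegral_indicator measurableSet_Ioi, Ioi_inter_Ioi, sup_eq_right.2 hc.le,
        integral_Ioi_rpow_of_lt (by linarith) hc, show -α - 1 + 1 = -α by ring, neg_div_neg_eq]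
    have hpowint : ∀ c : ℝ, 0 < c → IntegrableOn ((Ioi c).indicator (fun s : ℝ => s ^ (-α - 1))) (Ioi 0) :=
      fun c hc => ((integrableOn_Ioi_rpow_of_lt (by linarith) hc).integrable_indicator
        measurableSet_Ioi).integrableOn
    have hle : ∀ s ∈ Ioi (0 : ℝ), s ^ (-α - 1) * χ (1 / (1 + s ^ 2)) ≤
        (Ioi a).indicator (fun s => s ^ (-α - 1)) s := by
      intro s hs
      have hs0 : (0 : ℝ) < s := hs
      by_cases hsa : a < s
      · rw [indicator_of_mem (mem_Ioi.2 hsa)]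
        exact mul_le_of_le_one_right (by positivity) (hχ1 _)
      · rw [hlow s hs0.le (not_lt.1 hsa), mul_zero, indicator_of_notMem (by simpa using hsa)]
    have hge : ∀ s ∈ Ioi (0 : ℝ), (Ioi b).indicator (fun s => s ^ (-α - 1)) s ≤
        s ^ (-α - 1) * χ (1 / (1 + s ^ 2)) := by
      intro s hs
      have hs0 : (0 : ℝ) < s := hs
      by_cases hsb : b < s
      · rw [indicator_of_mem (mem_Ioi.2 hsb), hupp s hsb.le, mul_one]
      · rw [indicator_of_notMem (by simpa using hsb)]
        exact mul_nonneg (by positivity) (hχ0 _)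
    have hχint : IntegrableOn (fun s : ℝ => s ^ (-α - 1) * χ (1 / (1 + s ^ 2))) (Ioi 0) := by
      refine (hpowint a ha).mono' (Measurable.aestronglyMeasurable (by fun_prop)) ?_
      filter_upwards [ae_restrict_mem measurableSet_Ioi] with s hs
      have hs0 : (0 : ℝ) < s := hs
      rw [Real.norm_of_nonneg (mul_nonneg (by positivity) (hχ0 _))]
      exact hle s hs
    refine ⟨_, _, htend, ?_, ?_, fun y hy => ?_⟩
    · rw [hI2, ← hpow b hb]
      exact div_le_div_of_nonneg_right
        (setIntegral_mono_on (hpowint b hb) hχint measurableSet_Ioi hge) hI0.le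
    · rw [hI2, ← hpow a ha]
      exact div_le_div_of_nonneg_right
        (setIntegral_mono_on hχint (hpowint a ha) measurableSet_Ioi hle) hI0.le
    · have e : ∫ t, (t / y) ^ (p + 1) / (1 + (t / y) ^ 2) * φ (invOneAddSq (t / y)) ∂μ =
          ∫ t, χ (1 / (1 + (t / y) ^ 2)) ∂μ := by
        refine integral_congr_ae ?_
        filter_upwards [hμ] with t ht using hφ _ (by positivity)
      have hi : Integrable (fun t => χ (1 / (1 + (t / y) ^ 2))) μ := by
        refine (integrable_const (1 : ℝ)).mono'
          (hmeas.comp (measurable_id.div_const y)).aestronglyMeasurable (ae_of_all _ fun t => ?_)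
        rw [Real.norm_of_nonneg (hχ0 _)]
        exact hχ1 _
      have hind : ∀ c : ℝ, Integrable ((Ioi (c * y)).indicator (1 : ℝ → ℝ)) μ := fun c =>
        (integrable_const (1 : ℝ)).indicator measurableSet_Ioi
      rw [e, ← integral_indicator_one measurableSet_Ioi, ← integral_indicator_one measurableSet_Ioi]
      have hFy := hFpos y hy
      constructor
      · refine div_le_div_of_nonneg_right (integral_mono (hind b) hi fun t => ?_) hFy.le
        by_cases ht : b * y < t
        · rw [indicator_of_mem (mem_Ioi.2 ht)]
          simp only [Pi.one_apply]
          rw [hupp (t / y) ((le_div_iff₀ hy).2 ht.le)]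
        · rw [indicator_of_notMem (by simpa using ht)]
          exact hχ0 _
      · refine div_le_div_of_nonneg_right (integral_mono_ae hi (hind a) ?_) hFy.le
        filter_upwards [hμ] with t ht0
        by_cases ht : a * y < t
        · rw [indicator_of_mem (mem_Ioi.2 ht)]
          exact hχ1 _
        · rw [indicator_of_notMem (by simpa using ht),
            hlow (t / y) (by positivity) ((div_le_iff₀ hy).2 (not_lt.1 ht))]
  have hcont : ContinuousAt (fun c : ℝ => c ^ (-α) / α / I) x :=
    ((Real.continuousAt_rpow_const _ _ (Or.inl hx.ne')).div_const _).div_const _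
  rw [tendsto_order]
  constructor
  · intro v hv
    have h1 := hcont.eventually_const_lt hv
    obtain ⟨b, hb1, hb2⟩ := ((h1.filter_mono nhdsWithin_le_nhds).and
      (self_mem_nhdsWithin : Ioi x ∈ 𝓝[>] x)).exists
    obtain ⟨G, L, hG, hL1, -, hGy⟩ := key x b hx hb2
    filter_upwards [hG.eventually_const_lt (hb1.trans_le hL1), eventually_gt_atTop 0] with y hy hy0
    exact hy.trans_le (hGy y hy0).2
  · intro v hv
    have h1 := hcont.eventually_lt_const hv
    obtain ⟨a, ha1, ha2⟩ := ((h1.filter_mono nhdsWithin_le_nhds).and (Ioo_mem_nhdsLT hx)).exists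
    obtain ⟨G, L, hG, -, hL2, hGy⟩ := key a x ha2.1 ha2.2
    filter_upwards [hG.eventually_lt_const (hL2.trans_lt ha1), eventually_gt_atTop 0] with y hy hy0
    exact (hGy y hy0).1.trans_lt hy

end Tauberian

/-! ### Asymptotics on the imaginary axis and the equivalences -/

section RegularVariation

/-- Asymptotic equivalence does not transport measurability, hence the separate continuity
hypothesis. -/
theorem RegularlyVarying.of_isEquivalent {f g : ℝ → ℝ} {ρ : ℝ}
    (hf : ∃ X : ℝ, ContinuousOn f (Ici X)) (hfg : f ~[atTop] g)
    (hg : ∀ t : ℝ, 0 < t → Tendsto (fun x => g (t * x) / g x) atTop (𝓝 (t ^ ρ))) :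
    RegularlyVarying f ρ := by
  obtain ⟨X, hX⟩ := hf
  refine ⟨⟨X, (continuousOn_iff_continuous_domRestrict.1 hX).measurable⟩, fun t ht => ?_⟩
  have h1 : (fun x => f (t * x)) ~[atTop] fun x => g (t * x) :=
    hfg.comp_tendsto (tendsto_id.const_mul_atTop ht)
  exact ((h1.div hfg).symm).tendsto_nhds (hg t ht)

end RegularVariation

namespace MemM

variable {p : ℕ} {μ : Measure ℝ}

theorem tail_pos (hμ : MemM p μ) (y : ℝ) : 0 < μ.real (Ioi y) := by
  have := hμ.isProbabilityMeasure
  by_contra! h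
  have h0 : μ (Ioi y) = 0 := by
    rwa [← measureReal_eq_zero_iff, ← measureReal_nonneg.ge_iff_eq']
  refine hμ.not_integrable_pow_succ
    ((integrable_const (|y| ^ (p + 1))).mono' (by fun_prop) ?_)
  filter_upwards [hμ.ae_nonneg, measure_eq_zero_iff_ae_notMem.1 h0] with t ht hty
  rw [norm_pow, Real.norm_of_nonneg ht]
  exact pow_le_pow_left₀ ht ((not_lt.1 hty).trans (le_abs_self y)) _

theorem halfLineApart_I_mul {y : ℝ} (hy : 0 < y) : HalfLineApart 2 (Complex.I * (y : ℂ)) := by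
  have := halfLineApart_of_norm_le (K := 1) (z := Complex.I * (y : ℂ)) (by simpa using hy)
    (by simp [abs_of_pos hy])
  norm_num at this
  exact this

theorem norm_I_mul_sub_sq (y t : ℝ) : ‖Complex.I * (y : ℂ) - t‖ ^ 2 = t ^ 2 + y ^ 2 := by
  rw [← Complex.normSq_eq_norm_sq, Complex.normSq_apply]
  simp
  ring

theorem im_remG_axis (hμ : MemM p μ) {y : ℝ} (hy : 0 < y) :
    (remG μ p (Complex.I * (y : ℂ))).im =
      -(y ^ p * ∫ t, (t / y) ^ (p + 1) / (1 + (t / y) ^ 2) ∂μ) := by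
  have := hμ.isProbabilityMeasure
  have hap := halfLineApart_I_mul hy
  rw [remG_eq_powCauchy hμ.ae_nonneg hμ.integrable_pow hap,
    im_powCauchy hμ.ae_nonneg hμ.integrable_pow hap, ← integral_const_mul, ← integral_const_mul]
  congr 1
  refine integral_congr_ae (ae_of_all _ fun t => ?_)
  simp only [norm_I_mul_sub_sq, Complex.mul_im, Complex.I_re, Complex.I_im, Complex.ofReal_im,
    Complex.ofReal_re, zero_mul, one_mul, zero_add]
  rw [div_pow, div_pow]
  field_simp
  ring

theorem re_remG_axis (hμ : MemM p μ) {y : ℝ} (hy : 0 < y) :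
    (remG μ p (Complex.I * (y : ℂ))).re =
      -(y ^ p * ∫ t, (t / y) ^ (p + 2) / (1 + (t / y) ^ 2) ∂μ) := by
  have := hμ.isProbabilityMeasure
  have hap := halfLineApart_I_mul hy
  have h := integral_re (integrable_pow_succ_div_sub hμ.ae_nonneg hμ.integrable_pow hap)
  rw [remG_eq_powCauchy hμ.ae_nonneg hμ.integrable_pow hap, powCauchy, ← integral_const_mul,
    ← integral_neg]
  refine h.symm.trans (integral_congr_ae (ae_of_all _ fun t => ?_))
  simp only [RCLike.re_eq_complex_re]
  rw [← Complex.ofReal_pow, Complex.div_re, Complex.normSq_eq_norm_sq, norm_I_mul_sub_sq]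
  simp only [Complex.mul_re, Complex.I_re, Complex.I_im, Complex.ofReal_im,
    Complex.ofReal_re, Complex.sub_re, zero_mul, mul_zero, sub_zero, zero_sub, zero_div, add_zero]
  rw [div_pow, div_pow]
  field_simp
  ring

theorem integrable_stieltjesKernel (hμ : MemM p μ) {y : ℝ} (hy : 0 < y) :
    Integrable (fun t => (t / y) ^ (p + 1) / (1 + (t / y) ^ 2)) μ := by
  refine ((integrable_pow_succ_div_sq hμ.ae_nonneg hμ.integrable_pow
    (halfLineApart_I_mul hy)).const_mul (y ^ 2 / y ^ (p + 1))).congr (ae_of_all _ fun t => ?_)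
  simp only [norm_I_mul_sub_sq]
  rw [div_pow, div_pow]
  field_simp
  ring

theorem integral_stieltjesKernel_pos (hμ : MemM p μ) {y : ℝ} (hy : 0 < y) :
    0 < ∫ t, (t / y) ^ (p + 1) / (1 + (t / y) ^ 2) ∂μ := by
  have := hμ.isProbabilityMeasure
  rw [integral_pos_iff_support_of_nonneg_ae ?_ (hμ.integrable_stieltjesKernel hy)]
  · have h0 : 0 < μ (Ioi 0) := by
      have := hμ.tail_pos 0
      exact (ENNReal.toReal_pos_iff.1 this).1
    refine h0.trans_le (measure_mono fun t ht => ?_)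
    have : 0 < t := ht
    exact ne_of_gt (by positivity)
  · filter_upwards [hμ.ae_nonneg] with t ht
    positivity

theorem exists_continuousOn_remG (hμ : MemM p μ) :
    ∃ X : ℝ, ContinuousOn (fun y : ℝ => remG μ p (Complex.I * y)) (Ici X) := by
  have := hμ.isProbabilityMeasure
  have hm : 0 ≤ realMoment μ p := integral_pow_nonneg hμ.ae_nonneg
  refine ⟨1, (LipschitzOnWith.of_dist_le_mul (K := ⟨2 ^ 2 * realMoment μ p, by positivity⟩)
    fun y hy y' hy' => ?_).continuousOn⟩
  have hy1 : 1 ≤ y := hy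
  have hy0 : 0 < y := by linarith
  have hy0' : 0 < y' := one_pos.trans_le hy'
  rw [dist_eq_norm, remG_eq_powCauchy hμ.ae_nonneg hμ.integrable_pow (halfLineApart_I_mul hy0),
    remG_eq_powCauchy hμ.ae_nonneg hμ.integrable_pow (halfLineApart_I_mul hy0')]
  refine (norm_powCauchy_sub_le hμ.ae_nonneg hμ.integrable_pow (halfLineApart_I_mul hy0)
    (halfLineApart_I_mul hy0')).trans ?_
  rw [← mul_sub, norm_mul, norm_mul, Complex.norm_I, one_mul, one_mul, ← Complex.ofReal_sub,
    Complex.norm_real, Complex.norm_real, Real.norm_of_nonneg hy0.le, Real.dist_eq]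
  show _ ≤ 2 ^ 2 * realMoment μ p * _
  gcongr
  exact div_le_self (norm_nonneg _) hy1

variable {α : ℝ}

theorem isEquivalent_im_remG (hp : 1 ≤ p) (hα : α ∈ Ioo (p : ℝ) (p + 1)) (hμ : MemM p μ)
    (h : RegularlyVarying (fun y : ℝ => μ.real (Ioi y)) (-α)) :
    (fun y : ℝ => (remG μ p (Complex.I * (y : ℂ))).im) ~[atTop]
      fun y : ℝ => -((Real.pi * α / 2) / Real.cos (Real.pi * (α - p) / 2)) *
        (y ^ p * μ.real (Ioi y)) := by
  have := hμ.isProbabilityMeasure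
  obtain ⟨h1, h2⟩ := hα
  have hα0 : 0 < α := (Nat.cast_nonneg p).trans_lt h1
  have hc := cos_pi_mul_div_two_pos (b := α - p) ⟨by linarith, by linarith⟩
  -- The imaginary part has kernel exponent `p + 1`, so the Abelian theorem is used with `m = p -
  -- 1`.
  obtain ⟨m, rfl⟩ := Nat.exists_eq_add_of_le' hp
  have e : α - m - 1 = α - (m + 1 : ℕ) := by push_cast; ring
  have key := tendsto_integral_stieltjesKernel_div hμ.ae_nonneg hμ.tail_pos hα0 h.2 m
    (by rw [e]; exact ⟨by linarith, by linarith⟩)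
  rw [e] at key
  rw [isEquivalent_iff_tendsto_one]
  · have hL : α * (Real.pi / (2 * Real.cos (Real.pi * (α - (m + 1 : ℕ)) / 2))) ≠ 0 := by positivity
    have k2 := key.div_const (α * (Real.pi / (2 * Real.cos (Real.pi * (α - (m + 1 : ℕ)) / 2))))
    rw [div_self hL] at k2
    refine k2.congr' ?_
    filter_upwards [eventually_gt_atTop 0] with y hy
    have hT := hμ.tail_pos y
    rw [Pi.div_apply, hμ.im_remG_axis hy]
    field_simp
  · filter_upwards [eventually_gt_atTop 0] with y hy
    have hT := hμ.tail_pos y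
    have : 0 < (Real.pi * α / 2) / Real.cos (Real.pi * (α - (m + 1 : ℕ)) / 2) *
        (y ^ (m + 1) * μ.real (Ioi y)) := by positivity
    rw [neg_mul]
    exact neg_ne_zero.2 this.ne'

/-- The kernel exponent is now `p + 2`; this shifts the cosine's argument by `π/2` and produces the
sine. -/
theorem isEquivalent_re_remG (hα : α ∈ Ioo (p : ℝ) (p + 1)) (hμ : MemM p μ)
    (h : RegularlyVarying (fun y : ℝ => μ.real (Ioi y)) (-α)) :
    (fun y : ℝ => (remG μ p (Complex.I * (y : ℂ))).re) ~[atTop]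
      fun y : ℝ => -((Real.pi * α / 2) / Real.sin (Real.pi * (α - p) / 2)) *
        (y ^ p * μ.real (Ioi y)) := by
  have := hμ.isProbabilityMeasure
  obtain ⟨h1, h2⟩ := hα
  have hα0 : 0 < α := (Nat.cast_nonneg p).trans_lt h1
  have hmem : α - p - 1 ∈ Ioo (-1 : ℝ) 1 := ⟨by linarith, by linarith⟩
  have hc := cos_pi_mul_div_two_pos hmem
  have key := tendsto_integral_stieltjesKernel_div hμ.ae_nonneg hμ.tail_pos hα0 h.2 p hmem
  have e : Real.cos (Real.pi * (α - p - 1) / 2) = Real.sin (Real.pi * (α - p) / 2) := by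
    rw [show Real.pi * (α - p - 1) / 2 = Real.pi * (α - p) / 2 - Real.pi / 2 by ring,
      Real.cos_sub_pi_div_two]
  rw [e] at key hc
  rw [isEquivalent_iff_tendsto_one]
  · have hL : α * (Real.pi / (2 * Real.sin (Real.pi * (α - p) / 2))) ≠ 0 := by positivity
    have k2 := key.div_const (α * (Real.pi / (2 * Real.sin (Real.pi * (α - p) / 2))))
    rw [div_self hL] at k2
    refine k2.congr' ?_
    filter_upwards [eventually_gt_atTop 0] with y hy
    have hT := hμ.tail_pos y
    rw [Pi.div_apply, hμ.re_remG_axis hy]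
    field_simp
  · filter_upwards [eventually_gt_atTop 0] with y hy
    have hT := hμ.tail_pos y
    have : 0 < (Real.pi * α / 2) / Real.sin (Real.pi * (α - p) / 2) *
        (y ^ p * μ.real (Ioi y)) := by positivity
    rw [neg_mul]
    exact neg_ne_zero.2 this.ne'

/-- The bound is inherited from `Im r_G(iy)`, which dominates `1/y` for every measure in the class.
-/
theorem isLittleO_inv_pow_mul_tail (hp : 1 ≤ p) (hα : α ∈ Ioo (p : ℝ) (p + 1)) (hμ : MemM p μ)
    (h : RegularlyVarying (fun y : ℝ => μ.real (Ioi y)) (-α)) :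
    (fun y : ℝ => y⁻¹) =o[atTop] fun y : ℝ => y ^ p * μ.real (Ioi y) :=
  (hμ.isLittleO_inv_im_remG.trans_isBigO (hμ.isEquivalent_im_remG hp hα h).isBigO).trans_isBigO
    (isBigO_const_mul_self _ _ _)

theorem isLittleO_inv_re_remG (hp : 1 ≤ p) (hα : α ∈ Ioo (p : ℝ) (p + 1)) (hμ : MemM p μ)
    (h : RegularlyVarying (fun y : ℝ => μ.real (Ioi y)) (-α)) :
    (fun y : ℝ => y⁻¹) =o[atTop] fun y : ℝ => (remG μ p (Complex.I * (y : ℂ))).re := by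
  refine ((hμ.isLittleO_inv_pow_mul_tail hp hα h).const_mul_right (c :=
    -((Real.pi * α / 2) / Real.sin (Real.pi * (α - p) / 2))) ?_).trans_isBigO
    (hμ.isEquivalent_re_remG hα h).symm.isBigO
  have hα0 : 0 < α := (Nat.cast_nonneg p).trans_lt hα.1
  have hs : 0 < Real.sin (Real.pi * (α - p) / 2) :=
    Real.sin_pos_of_pos_of_lt_pi (by nlinarith [Real.pi_pos, hα.1]) (by nlinarith [Real.pi_pos, hα.2])
  exact neg_ne_zero.2 (by positivity)

theorem isEquivalent_im_remPhi (hp : 1 ≤ p) (hμ : MemM p μ) :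
    (fun y : ℝ => (remPhi μ p (Complex.I * (y : ℂ))).im) ~[atTop]
      fun y : ℝ => (remG μ p (Complex.I * (y : ℂ))).im :=
  (IsBigO.of_bound 1 (Eventually.of_forall fun y => by
    simpa using Complex.abs_im_le_norm
      (remPhi μ p (Complex.I * y) - remG μ p (Complex.I * y)))).trans_isLittleO
    ((hμ.isBigO_axis_remPhi_sub_remG hp).trans_isLittleO hμ.isLittleO_inv_im_remG)

theorem isEquivalent_re_remPhi (hp : 1 ≤ p) (hα : α ∈ Ioo (p : ℝ) (p + 1)) (hμ : MemM p μ)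
    (h : RegularlyVarying (fun y : ℝ => μ.real (Ioi y)) (-α)) :
    (fun y : ℝ => (remPhi μ p (Complex.I * (y : ℂ))).re) ~[atTop]
      fun y : ℝ => (remG μ p (Complex.I * (y : ℂ))).re :=
  (IsBigO.of_bound 1 (Eventually.of_forall fun y => by
    simpa using Complex.abs_re_le_norm
      (remPhi μ p (Complex.I * y) - remG μ p (Complex.I * y)))).trans_isLittleO
    ((hμ.isBigO_axis_remPhi_sub_remG hp).trans_isLittleO (hμ.isLittleO_inv_re_remG hp hα h))

theorem isEquivalent_remPhi (hp : 1 ≤ p) (hμ : MemM p μ) : remPhi μ p ~[ntAtInfty] remG μ p :=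
  hμ.isLittleO_remPhi_sub_remG hp

theorem isLittleO_inv_remPhi (hp : 1 ≤ p) (hμ : MemM p μ) :
    (fun z : ℂ => z⁻¹) =o[ntAtInfty] remPhi μ p :=
  hμ.isLittleO_inv_remG.trans_isBigO (hμ.isEquivalent_remPhi hp).symm.isBigO

theorem regularlyVarying_im_remG (hp : 1 ≤ p) (hα : α ∈ Ioo (p : ℝ) (p + 1)) (hμ : MemM p μ)
    (h : RegularlyVarying (fun y : ℝ => μ.real (Ioi y)) (-α)) :
    RegularlyVarying (fun y : ℝ => (remG μ p (Complex.I * (y : ℂ))).im) (-(α - p)) := by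
  obtain ⟨X, hX⟩ := hμ.exists_continuousOn_remG
  have hα0 : 0 < α := (Nat.cast_nonneg p).trans_lt hα.1
  have hc := cos_pi_mul_div_two_pos (b := α - p) ⟨by linarith [hα.1], by linarith [hα.2]⟩
  refine RegularlyVarying.of_isEquivalent ⟨X, Complex.continuous_im.comp_continuousOn hX⟩
    (hμ.isEquivalent_im_remG hp hα h) fun t ht => ?_
  have e : t ^ (-(α - p)) = t ^ p * t ^ (-α) := by
    rw [← Real.rpow_natCast t p, ← Real.rpow_add ht]
    congr 1
    ring
  rw [e]
  refine ((h.2 t ht).const_mul (t ^ p)).congr' ?_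
  filter_upwards [eventually_gt_atTop 0] with y hy
  have hT := hμ.tail_pos y
  rw [mul_pow]
  field_simp

theorem regularlyVarying_tail (hp : 1 ≤ p) (hα : α ∈ Ioo (p : ℝ) (p + 1)) (hμ : MemM p μ)
    (h : RegularlyVarying (fun y : ℝ => (remG μ p (Complex.I * (y : ℂ))).im) (-(α - p))) :
    RegularlyVarying (fun y : ℝ => μ.real (Ioi y)) (-α) := by
  have := hμ.isProbabilityMeasure
  have hα0 : 0 < α := (Nat.cast_nonneg p).trans_lt hα.1
  have hmem : α - p ∈ Ioo (-1 : ℝ) 1 := ⟨by linarith [hα.1], by linarith [hα.2]⟩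
  have hc := cos_pi_mul_div_two_pos hmem
  have hanti : Antitone fun y => μ.real (Ioi y) := fun a b hab =>
    measureReal_mono (Ioi_subset_Ioi hab)
  refine ⟨⟨0, hanti.measurable.comp measurable_subtype_coe⟩, fun x hx => ?_⟩
  set F : ℝ → ℝ := fun y => ∫ t, (t / y) ^ (p + 1) / (1 + (t / y) ^ 2) ∂μ with hF
  have hFpos : ∀ y, 0 < y → 0 < F y := fun y hy => hμ.integral_stieltjesKernel_pos hy
  have hratio : ∀ l, 0 < l → Tendsto (fun y => F (l * y) / F y) atTop (𝓝 (l ^ (-α))) := by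
    intro l hl
    have e : l ^ (-α) = (l ^ p)⁻¹ * l ^ (-(α - p)) := by
      rw [← Real.rpow_natCast l p, ← Real.rpow_neg hl.le, ← Real.rpow_add hl]
      congr 1
      ring
    rw [e]
    refine ((h.2 l hl).const_mul _).congr' ?_
    filter_upwards [eventually_gt_atTop 0] with y hy
    have := hFpos y hy
    rw [hμ.im_remG_axis hy, hμ.im_remG_axis (mul_pos hl hy)]
    change (l ^ p)⁻¹ * (-((l * y) ^ p * F (l * y)) / -(y ^ p * F y)) = _
    rw [mul_pow]
    field_simp
  have key : ∀ x : ℝ, 0 < x → _ := fun x hx => tendsto_tail_div_of_regularlyVarying hμ.ae_nonneg hp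
    hα0 hmem (F := F) (fun y _ => rfl) hFpos (fun y hy => hμ.integrable_stieltjesKernel hy) hratio hx
  have h1 := key 1 one_pos
  rw [Real.one_rpow] at h1
  -- Dividing the limits of tail over `F` at `x` and at `1` eliminates `F` and the constant.
  have h2 := (key x hx).div h1 (by positivity)
  have e : x ^ (-α) / α / (Real.pi / (2 * Real.cos (Real.pi * (α - p) / 2))) /
      (1 / α / (Real.pi / (2 * Real.cos (Real.pi * (α - p) / 2)))) = x ^ (-α) := by
    field_simp
  rw [e] at h2
  refine h2.congr' ?_
  filter_upwards [eventually_gt_atTop 0] with y hy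
  have := hFpos y hy
  have := hμ.tail_pos y
  rw [Pi.div_apply, one_mul]
  field_simp

end MemM

theorem mainTheorem3 (p : ℕ) (hp : 1 ≤ p) (α : ℝ) (hα : α ∈ Set.Ioo (p : ℝ) ((p : ℝ) + 1))
    (μ : Measure ℝ) (hμ : MemM p μ) :
    List.TFAE
      [RegularlyVarying (fun y : ℝ => μ.real (Set.Ioi y)) (-α),
       RegularlyVarying (fun y : ℝ => (remG μ p (Complex.I * (y : ℂ))).im) (-(α - p)),
       RegularlyVarying (fun y : ℝ => (remPhi μ p (Complex.I * (y : ℂ))).im) (-(α - p)) ∧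
         ((fun y : ℝ => y⁻¹) =o[atTop] fun y : ℝ => (remPhi μ p (Complex.I * (y : ℂ))).re) ∧
         ((fun z : ℂ => z⁻¹) =o[ntAtInfty] remPhi μ p)] ∧
    (RegularlyVarying (fun y : ℝ => μ.real (Set.Ioi y)) (-α) →
      ((remG μ p ~[ntAtInfty] remPhi μ p) ∧
        ((fun z : ℂ => z⁻¹) =o[ntAtInfty] remPhi μ p)) ∧
      (((fun y : ℝ => (remPhi μ p (Complex.I * (y : ℂ))).im) ~[atTop]
          fun y : ℝ => (remG μ p (Complex.I * (y : ℂ))).im) ∧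
        ((fun y : ℝ => (remG μ p (Complex.I * (y : ℂ))).im) ~[atTop]
          fun y : ℝ => -((Real.pi * α / 2) / Real.cos (Real.pi * (α - p) / 2)) *
            (y ^ p * μ.real (Set.Ioi y))) ∧
        ((fun y : ℝ => y⁻¹) =o[atTop] fun y : ℝ => y ^ p * μ.real (Set.Ioi y))) ∧
      (((fun y : ℝ => (remPhi μ p (Complex.I * (y : ℂ))).re) ~[atTop]
          fun y : ℝ => (remG μ p (Complex.I * (y : ℂ))).re) ∧
        ((fun y : ℝ => (remG μ p (Complex.I * (y : ℂ))).re) ~[atTop]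
          fun y : ℝ => -((Real.pi * α / 2) / Real.sin (Real.pi * (α - p) / 2)) *
            (y ^ p * μ.real (Set.Ioi y))))) := by
  have h32 : RegularlyVarying (fun y : ℝ => (remPhi μ p (Complex.I * (y : ℂ))).im) (-(α - p)) →
      RegularlyVarying (fun y : ℝ => (remG μ p (Complex.I * (y : ℂ))).im) (-(α - p)) := by
    intro h
    obtain ⟨X, hX⟩ := hμ.exists_continuousOn_remG
    exact RegularlyVarying.of_isEquivalent ⟨X, Complex.continuous_im.comp_continuousOn hX⟩
      (hμ.isEquivalent_im_remPhi hp).symm h.2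
  have h23 : RegularlyVarying (fun y : ℝ => (remG μ p (Complex.I * (y : ℂ))).im) (-(α - p)) →
      RegularlyVarying (fun y : ℝ => (remPhi μ p (Complex.I * (y : ℂ))).im) (-(α - p)) := by
    intro h
    obtain ⟨X, hX⟩ := hμ.exists_continuousOn_remPhi hp
    exact RegularlyVarying.of_isEquivalent ⟨X, Complex.continuous_im.comp_continuousOn hX⟩
      (hμ.isEquivalent_im_remPhi hp) h.2
  refine ⟨?_, fun h => ⟨⟨(hμ.isEquivalent_remPhi hp).symm, hμ.isLittleO_inv_remPhi hp⟩,
    ⟨hμ.isEquivalent_im_remPhi hp, hμ.isEquivalent_im_remG hp hα h,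
      hμ.isLittleO_inv_pow_mul_tail hp hα h⟩,
    hμ.isEquivalent_re_remPhi hp hα h, hμ.isEquivalent_re_remG hα h⟩⟩
  tfae_have 1 → 2 := hμ.regularlyVarying_im_remG hp hα
  tfae_have 2 → 1 := hμ.regularlyVarying_tail hp hα
  tfae_have 3 → 2 := fun h => h32 h.1
  tfae_have 2 → 3 := by
    intro h
    -- The real-part condition is obtained by going back to the tail, whose asymptotics bound `Re
    -- r_G(iy)` from below.
    have h1 := hμ.regularlyVarying_tail hp hα h
    exact ⟨h23 h, (hμ.isLittleO_inv_re_remG hp hα h1).trans_isBigO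
      (hμ.isEquivalent_re_remPhi hp hα h1).symm.isBigO, hμ.isLittleO_inv_remPhi hp⟩
  tfae_finish
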